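/- Let $\mathcal G=(X,E)$ be a finite graph without loop-edges or multiple edges, with conductances $C_{x,y}=C_{y,x}\ge 0$ (zero if $\{x,y\}\notin E$) and a killing measure $\kappa_x\ge 0$, such that the energy $\mathcal E(f,f)=\frac12\sum_{x,y}C_{x,y}(f(x)-f(y))^2+\sum_x\kappa_xf(x)^2$ is positive definite. Put $\lambda_x=\sum_yC_{x,y}+\kappa_x$ and let $P^x_y=C_{x,y}/\lambda_x$ be the probability of a jump from $x$ to $y$; the associated Markov process $(X_t)$ makes jumps according to $P$ (and is killed with the missing mass) after independent exponential holding times of mean $1$. Its loop measure $\mu$ is the image, on loops (i.e. based loops modulo translation of the base point, one-point loops included), of the measure $\sum_x\int_0^\infty \frac1t\,\mathbb P_x\big((X_s)_{0\le s\le t}\in\cdot\,,\,X_t=x\big)\,dt$ on based loops. For $\alpha>0$ let $\mathcal L_\alpha$ be a Poisson process of loops of intensity $\alpha\mu$; let $N^{(\alpha)}_{x,y}$ be the total number of jumps from $x$ to $y$ ($x\ne y$) made by the loops of $\mathcal L_\alpha$, put $N^{(\alpha)}_{x,x}=0$ and $N^{(\alpha)}_{\{x,y\}}=N^{(\alpha)}_{x,y}+N^{(\alpha)}_{y,x}$,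 and let $\widehat{\mathcal L}_\alpha^x$ be the total time spent at $x$ by the loops of $\mathcal L_\alpha$, divided by $\lambda_x$. Let $X$ be the disjoint union of $X_1$ and $X_2$. Then: (i) conditionally on the family $(N^{(1)}_{x,y},N^{(1)}_{y,x})_{x\in X_1,\,y\in X_2}$, the restricted fields $\big((N^{(1)}_{x,y})_{x,y\in X_1},(\widehat{\mathcal L}_1^x)_{x\in X_1}\big)$ and $\big((N^{(1)}_{x,y})_{x,y\in X_2},(\widehat{\mathcal L}_1^x)_{x\in X_2}\big)$ are independent; (ii) conditionally on the family $(N^{(1/2)}_{\{x,y\}})_{x\in X_1,\,y\in X_2}$, the restricted fields $\big((N^{(1/2)}_{\{x,y\}})_{x,y\in X_1},(\widehat{\mathcal L}_{1/2}^x)_{x\in X_1}\big)$ and $\big((N^{(1/2)}_{\{x,y\}})_{x,y\in X_2},(\widehat{\mathcal L}_{1/2}^x)_{x\in X_2}\big)$ are independent. -/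

import Mathlib

open MeasureTheory ProbabilityTheory
open scoped ENNReal NNReal

/-- A finite graph without loop-edges or multiple edges, with non-negative symmetric conductances
carried by its edges and a non-negative killing measure on its vertices. -/
structure ElectricalNetwork (X : Type*) where
  graph : SimpleGraph X
  cond : X → X → ℝ
  cond_nonneg : ∀ x y, 0 ≤ cond x y
  cond_symm : ∀ x y, cond x y = cond y x
  cond_eq_zero : ∀ x y, ¬ graph.Adj x y → cond x y = 0
  kill : X → ℝ
  kill_nonneg : ∀ x, 0 ≤ kill x

namespace ElectricalNetwork

variable {X : Type*} [Fintype X] (𝒢 : ElectricalNetwork X)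

/-- The Dirichlet form `(1/2) ∑ C_{x,y} (f x - f y)^2 + ∑ κ_x (f x)^2`. -/
noncomputable def energy (f : X → ℝ) : ℝ :=
  (1 / 2) * ∑ x, ∑ y, 𝒢.cond x y * (f x - f y) ^ 2 + ∑ x, 𝒢.kill x * f x ^ 2

/-- Transience: the energy is positive definite. -/
def Transient : Prop := ∀ f : X → ℝ, f ≠ 0 → 0 < 𝒢.energy f

/-- The duality measure `λ_x = ∑_y C_{x,y} + κ_x`. -/
noncomputable def dual (x : X) : ℝ := ∑ y, 𝒢.cond x y + 𝒢.kill x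

/-- The (sub-Markovian) probability `C_{x,y} / λ_x` of a jump from `x` to `y`. -/
noncomputable def transition (x y : X) : ℝ := 𝒢.cond x y / 𝒢.dual x

end ElectricalNetwork

/-- A based loop with `p` jumps, recorded by the vertices `x_0, x_1, …, x_p` it visits successively
and the times `u_0, …, u_p` it spends there.  It is a path of duration `t = u_0 + ⋯ + u_p`, which
starts at `x_0` and ends at `x_p = x_0` (the loop measure below is carried by the paths that do end
where they start). -/
def BasedLoop (X : Type*) : Type _ := Σ p : ℕ, (Fin (p + 1) → X) × (Fin (p + 1) → ℝ)

/-- The based loop with given vertices and holding times. -/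
def BasedLoop.mk {X : Type*} {p : ℕ} (x : Fin (p + 1) → X) (u : Fin (p + 1) → ℝ) : BasedLoop X :=
  ⟨p, x, u⟩

/-- Vertices carry the discrete σ-algebra and times the Borel σ-algebra. -/
instance (X : Type*) : MeasurableSpace (BasedLoop X) :=
  letI : MeasurableSpace X := ⊤
  inferInstanceAs (MeasurableSpace (Σ p : ℕ, (Fin (p + 1) → X) × (Fin (p + 1) → ℝ)))

/-- A loop: a based loop modulo translation of the base point along the loop, i.e. a cyclically
ordered finite sequence of pairs (visited vertex, holding time).  One-point loops are the cycles of
length one. -/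
def Loop (X : Type*) : Type _ := Cycle (X × ℝ)

/-- The loop of a based loop.  When there is at least one jump, the initial and the final stay at
the base point are consecutive stays of the loop and are merged into one. -/
def BasedLoop.toLoop {X : Type*} : BasedLoop X → Loop X
  | ⟨0, x, u⟩ => (([(x 0, u 0)] : List (X × ℝ)) : Cycle (X × ℝ))
  | ⟨p + 1, x, u⟩ => ((List.ofFn fun i : Fin (p + 1) =>
      (x i.castSucc, u i.castSucc + if i = 0 then u (Fin.last (p + 1)) else 0) :
        List (X × ℝ)) : Cycle (X × ℝ))

/-- The quotient σ-algebra: a set of loops is measurable iff the corresponding set of based loops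
is. -/
instance (X : Type*) : MeasurableSpace (Loop X) :=
  MeasurableSpace.map BasedLoop.toLoop inferInstance

namespace Loop

variable {X : Type*}

open Classical in
/-- The number of jumps from `x` to `y` (`x ≠ y`) made by a loop: the number of stays at `x` which
are cyclically followed by a stay at `y`. -/
noncomputable def jumps (x y : X) : Loop X → ℕ :=
  Quotient.lift
    (fun l : List (X × ℝ) =>
      (l.zip (l.rotate 1)).countP (fun q => decide (x ≠ y ∧ q.1.1 = x ∧ q.2.1 = y)))
    (by
      rintro l _ ⟨n, rfl⟩
      have h : (l.rotate n).zip ((l.rotate n).rotate 1) = (l.zip (l.rotate 1)).rotate n := by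
        rw [List.rotate_rotate, Nat.add_comm, ← List.rotate_rotate]
        exact (List.zipWith_rotate_distrib Prod.mk l (l.rotate 1) n (by simp)).symm
      simp only [h]
      exact ((List.rotate_perm _ n).countP_eq _).symm)

open Classical in
/-- The total time spent at `x` by a loop. -/
noncomputable def time (x : X) (l : Loop X) : ℝ≥0∞ :=
  (((Cycle.toMultiset l).filter (fun a => a.1 = x)).map (fun a => ENNReal.ofReal a.2)).sum

end Loop

namespace ElectricalNetwork

variable {X : Type*} [Fintype X] (𝒢 : ElectricalNetwork X)

open Classical in
/-- The weight `∏ P^{x_{i-1}}_{x_i}` of a sequence of vertices `x_0, …, x_p` with `x_p = x_0`. -/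
noncomputable def loopWeight {p : ℕ} (x : Fin (p + 1) → X) : ℝ≥0∞ :=
  if x (Fin.last p) = x 0 then ∏ i : Fin p, ENNReal.ofReal (𝒢.transition (x i.castSucc) (x i.succ))
  else 0

/-- The measure `(1/t) e^{-t} du_0 ⋯ du_p`, `t = u_0 + ⋯ + u_p`, on sequences of positive times. -/
noncomputable def timeMeasure (p : ℕ) : Measure (Fin (p + 1) → ℝ) :=
  (volume.restrict {u : Fin (p + 1) → ℝ | ∀ i, 0 < u i}).withDensity
    (fun u => ENNReal.ofReal (Real.exp (-∑ i, u i) / ∑ i, u i))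

/-- The measure `∑_x ∫_0^∞ (1/t) P_t^{x,x} λ_x dt` on based loops, where `P_t^{x,x} λ_x` is the law
on `[0, t]` of the Markov process with independent exponential holding times of mean `1` and jumps
governed by `transition`, started at `x` and restricted to the event that it is at `x` at time `t`.
On that event, the paths with `p` jumps which visit `x = x_0, x_1, …, x_p = x` have the density
`∏ P^{x_{i-1}}_{x_i} e^{-t}` with respect to `du_0 ⋯ du_{p-1}`, on `u_0 + ⋯ + u_{p-1} < t`; and the
integration in `t` is an integration in the last stay `u_p = t - (u_0 + ⋯ + u_{p-1})`. -/
noncomputable def basedLoopMeasure : Measure (BasedLoop X) :=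
  Measure.sum fun p : ℕ => ∑ x : Fin (p + 1) → X,
    𝒢.loopWeight x • (timeMeasure p).map (BasedLoop.mk x)

/-- The loop measure `μ`: the image of the measure on based loops. -/
noncomputable def loopMeasure : Measure (Loop X) :=
  𝒢.basedLoopMeasure.map BasedLoop.toLoop

end ElectricalNetwork

/-- `η` is (the counting measure of) a Poisson point process of intensity `ν`: the number of points
in a measurable set `A` is a Poisson variable of mean `ν A` (almost surely infinite if `ν A = ∞`),
and the numbers of points in disjoint measurable sets are independent. -/
structure IsPoissonProcess {Ω E : Type*} [MeasurableSpace Ω] [MeasurableSpace E]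
    (P : Measure Ω) (η : Ω → Measure E) (ν : Measure E) : Prop where
  measurable : Measurable η
  law : ∀ A, MeasurableSet A → ν A ≠ ∞ →
    P.map (fun ω => η ω A) = (poissonMeasure (ν A).toNNReal).map (fun n : ℕ => (n : ℝ≥0∞))
  law_top : ∀ A, MeasurableSet A → ν A = ∞ → ∀ᵐ ω ∂P, η ω A = ∞
  indep : ∀ (n : ℕ) (A : Fin n → Set E), (∀ i, MeasurableSet (A i)) →
    Pairwise (fun i j => Disjoint (A i) (A j)) → iIndepFun (fun i ω => η ω (A i)) P

section Fields

variable {X Ω : Type*} [Fintype X]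

/-- `N_{x,y}`: the total number of jumps from `x` to `y` made by the loops of the ensemble with
counting measure `η ω`. -/
noncomputable def jumpField (η : Ω → Measure (Loop X)) (ω : Ω) (x y : X) : ℝ≥0∞ :=
  ∫⁻ l, (Loop.jumps x y l : ℝ≥0∞) ∂(η ω)

/-- `N_{{x,y}} = N_{x,y} + N_{y,x}`. -/
noncomputable def symJumpField (η : Ω → Measure (Loop X)) (ω : Ω) (x y : X) : ℝ≥0∞ :=
  jumpField η ω x y + jumpField η ω y x

/-- The occupation field: the total time spent at `x` by the loops, divided by `λ_x`. -/
noncomputable def occupationField (𝒢 : ElectricalNetwork X) (η : Ω → Measure (Loop X)) (ω : Ω)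
    (x : X) : ℝ≥0∞ :=
  (∫⁻ l, Loop.time x l ∂(η ω)) / ENNReal.ofReal (𝒢.dual x)

/-- The restriction to the set `S` of vertices of an edge field and a vertex field. -/
def restrictFields (S : Set X) (N : Ω → X → X → ℝ≥0∞) (L : Ω → X → ℝ≥0∞) (ω : Ω) :
    (S → S → ℝ≥0∞) × (S → ℝ≥0∞) :=
  (fun x y => N ω x y, fun x => L ω x)

end Fields

/-- The random variables `F₁` and `F₂` are conditionally independent given the random variable `C`,
i.e. `P(F₁ ∈ A, F₂ ∈ B | C) = P(F₁ ∈ A | C) P(F₂ ∈ B | C)` almost surely for all measurable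
`A`, `B`. -/
def CondIndepGiven {Ω S₁ S₂ T : Type*} [MeasurableSpace Ω] [MeasurableSpace S₁]
    [MeasurableSpace S₂] [mT : MeasurableSpace T] (P : Measure Ω)
    (F₁ : Ω → S₁) (F₂ : Ω → S₂) (C : Ω → T) : Prop :=
  Measurable F₁ ∧ Measurable F₂ ∧ Measurable C ∧
    ∀ (A : Set S₁) (B : Set S₂), MeasurableSet A → MeasurableSet B →
      P⟦F₁ ⁻¹' A ∩ F₂ ⁻¹' B | mT.comap C⟧ =ᵐ[P]
        P⟦F₁ ⁻¹' A | mT.comap C⟧ * P⟦F₂ ⁻¹' B | mT.comap C⟧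

/-! The joint law of the edge field and the occupation field can be computed explicitly, and it has
a density that is a product over the vertices; conditional independence is then read off from this
product.

The Laplace functional of a Poisson process gives the joint Laplace transform of the fields as `exp
(-α ∫ (1 - e^{-F}) dμ)`, with `F` a linear combination of jump numbers and times. Write `M(s, b) = λ
+ b - sC`, where the factors `s = e^{-a}` mark jumps and `b` marks time. Then the integral is `log
det M(s, b) - log det M(1, 0)` (`lintegral_one_sub_expNeg_loopFunctional`). To see this, write `1/t`
as the integral of `e^{-rt}` over `r > 0`. The sum over loops becomes a difference of traces of
resolvents, by the Neumann series, and this difference is the `r`-derivative of a difference of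
logarithms of determinants.

The Laplace transform is therefore `(det M(1, 0) / det M(s, b))^α`. For `α = 1` it is a ratio of
complex Gaussian integrals, valid also for a non-symmetric `M` (`integral_cexp_neg_sesquilinear`),
so both orientations of a jump can be marked separately. For `α = 1/2` it is a ratio of real
Gaussian integrals; these need a symmetric `M`, hence see only `N_{x,y} + N_{y,x}`.

In such an integral the factors `exp (s C z_x z̄_y)` are, up to constants, generating functions of
independent Poisson numbers `n_{x,y}` of mean `C_{x,y}`. After an exchange of integrals
(`lintegral_spin_expansion`), the phase or sign of each `z_x` integrates out. What remains at `x` is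
a nonnegative weight depending on `|z_x|²` and on the numbers of jumps out of and into `x`. Since
Laplace transforms determine laws on `[0, ∞]`, the pair (jumps, occupation) is distributed like `(n,
|z|²)` under this density (`IsPoissonProcess.law_fields`). Finiteness of the fields never has to be
proved.

Finally, the numbers `n` on edges inside `X₁`, inside `X₂` and across are independent, and each
vertex weight depends only on the observed counts at the adjacent edges. Once the crossing counts
are fixed, the density splits into a function of the data in `X₁` times a function of the data in
`X₂` (`condIndepGiven_of_law`). -/

/-! ### The exponential on `[0, ∞]`. -/

/-- The function `y ↦ e^{-y}` on `[0, ∞]`. -/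
noncomputable def expNeg (y : ℝ≥0∞) : ℝ≥0∞ := EReal.exp (-(y : EReal))

theorem expNeg_zero : expNeg 0 = 1 := by simp [expNeg]

theorem expNeg_top : expNeg ∞ = 0 := by simp [expNeg]

theorem expNeg_ofReal {t : ℝ} (ht : 0 ≤ t) :
    expNeg (ENNReal.ofReal t) = ENNReal.ofReal (Real.exp (-t)) := by
  rw [expNeg, EReal.coe_ennreal_ofReal, max_eq_left ht, ← EReal.coe_neg, EReal.exp_coe]

theorem expNeg_add (a b : ℝ≥0∞) : expNeg (a + b) = expNeg a * expNeg b := by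
  rcases eq_or_ne a ∞ with rfl | ha
  · simp [expNeg_top]
  rcases eq_or_ne b ∞ with rfl | hb
  · simp [expNeg_top]
  rw [← ENNReal.ofReal_toReal ha, ← ENNReal.ofReal_toReal hb,
    ← ENNReal.ofReal_add ENNReal.toReal_nonneg ENNReal.toReal_nonneg,
    expNeg_ofReal ENNReal.toReal_nonneg, expNeg_ofReal ENNReal.toReal_nonneg,
    expNeg_ofReal (by positivity), ← ENNReal.ofReal_mul (by positivity), ← Real.exp_add, neg_add]

theorem expNeg_sum {ι : Type*} (s : Finset ι) (f : ι → ℝ≥0∞) :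
    expNeg (∑ i ∈ s, f i) = ∏ i ∈ s, expNeg (f i) := by
  classical
  induction s using Finset.induction_on with
  | empty => simp [expNeg_zero]
  | insert i s hi ih => rw [Finset.sum_insert hi, Finset.prod_insert hi, expNeg_add, ih]

theorem expNeg_natCast_mul (n : ℕ) (y : ℝ≥0∞) : expNeg (n * y) = expNeg y ^ n := by
  induction n with
  | zero => simp [expNeg_zero]
  | succ n ih => rw [Nat.cast_succ, add_mul, one_mul, expNeg_add, ih, pow_succ]

theorem expNeg_antitone : Antitone expNeg := fun _ _ h =>
  EReal.exp_monotone (EReal.neg_le_neg_iff.2 (EReal.coe_ennreal_le_coe_ennreal_iff.2 h))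

theorem expNeg_le_one (y : ℝ≥0∞) : expNeg y ≤ 1 :=
  expNeg_zero ▸ expNeg_antitone (zero_le)

theorem expNeg_ne_top (y : ℝ≥0∞) : expNeg y ≠ ∞ :=
  ((expNeg_le_one y).trans_lt ENNReal.one_lt_top).ne

theorem expNeg_injective : Function.Injective expNeg := fun a b h => by
  have := EReal.exp_strictMono.injective h
  simpa using this

theorem continuous_expNeg : Continuous expNeg :=
  ENNReal.continuous_exp.comp (continuous_neg.comp continuous_coe_ennreal_ereal)

theorem measurable_expNeg : Measurable expNeg := continuous_expNeg.measurable

theorem expNeg_lt_one {y : ℝ≥0∞} (hy : y ≠ 0) : expNeg y < 1 :=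
  lt_of_le_of_ne (expNeg_le_one y) fun h => hy (expNeg_injective (h.trans expNeg_zero.symm))

/-- The Laplace transform of a Poisson variable. -/
theorem lintegral_poissonMeasure_expNeg (r : ℝ≥0) (c : ℝ≥0∞) :
    ∫⁻ n : ℕ, expNeg (c * n) ∂poissonMeasure r = expNeg ((1 - expNeg c) * r) := by
  obtain ⟨q, hq⟩ : ∃ q : ℝ≥0, expNeg c = q := ⟨_, (ENNReal.coe_toNNReal (expNeg_ne_top c)).symm⟩
  have hq1 : (q : ℝ) ≤ 1 := by
    have := expNeg_le_one c
    rw [hq] at this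
    exact_mod_cast this
  have hsum : HasSum (fun n : ℕ => Real.exp (-r) * r ^ n / n.factorial * (q : ℝ) ^ n)
      (Real.exp (-((1 - q) * r))) := by
    have h := (NormedSpace.expSeries_div_hasSum_exp ((r : ℝ) * q)).mul_left (Real.exp (-r))
    rw [← Real.exp_eq_exp_ℝ, ← Real.exp_add] at h
    convert! h using 1
    · ext n; rw [mul_pow]; ring
    · congr 1; ring
  rw [poissonMeasure, lintegral_sum_measure]
  simp_rw [lintegral_smul_measure, lintegral_dirac, mul_comm c, expNeg_natCast_mul, hq]
  have h1 : (1 - (q : ℝ≥0∞)) * r = ENNReal.ofReal ((1 - q) * r) := by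
    rw [ENNReal.ofReal_mul (by linarith), ENNReal.ofReal_sub _ q.coe_nonneg]
    simp
  rw [h1, expNeg_ofReal (mul_nonneg (by linarith) r.coe_nonneg), ← hsum.tsum_eq,
    ENNReal.ofReal_tsum_of_nonneg (fun n => by positivity) hsum.summable]
  refine tsum_congr fun n => ?_
  rw [ENNReal.ofReal_mul (by positivity), smul_eq_mul, ENNReal.ofReal_pow q.coe_nonneg]
  simp

/-! ### Laplace functional of a Poisson process. -/

namespace IsPoissonProcess

variable {Ω E : Type*} [MeasurableSpace Ω] [MeasurableSpace E] {P : Measure Ω}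
  [IsProbabilityMeasure P] {η : Ω → Measure E} {ν : Measure E}

theorem lintegral_expNeg_mul (h : IsPoissonProcess P η ν) {A : Set E} (hA : MeasurableSet A)
    (c : ℝ≥0∞) : ∫⁻ ω, expNeg (c * η ω A) ∂P = expNeg ((1 - expNeg c) * ν A) := by
  rcases eq_or_ne c 0 with rfl | hc
  · simp [expNeg_zero]
  rcases eq_or_ne (ν A) ∞ with hν | hν
  -- A set of infinite intensity almost surely has infinitely many points, and `c ≠ 0`, so both
  -- sides vanish.
  · have h1 : 1 - expNeg c ≠ 0 := (tsub_pos_of_lt (expNeg_lt_one hc)).ne'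
    rw [hν, ENNReal.mul_top h1, expNeg_top, lintegral_eq_zero_iff']
    · filter_upwards [h.law_top A hA hν] with ω hω
      rw [hω, ENNReal.mul_top hc, expNeg_top]; rfl
    · exact (measurable_expNeg.comp
        (((Measure.measurable_coe hA).comp h.measurable).const_mul c)).aemeasurable
  · have hm : Measurable fun ω => η ω A := (Measure.measurable_coe hA).comp h.measurable
    have hf : Measurable fun y : ℝ≥0∞ => expNeg (c * y) :=
      measurable_expNeg.comp (measurable_id.const_mul c)
    rw [← lintegral_map (f := fun y => expNeg (c * y)) hf hm, h.law A hA hν,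
      lintegral_map hf (measurable_of_countable _), lintegral_poissonMeasure_expNeg,
      ENNReal.coe_toNNReal hν]

theorem lintegral_expNeg_simpleFunc (h : IsPoissonProcess P η ν) (f : SimpleFunc E ℝ≥0∞) :
    ∫⁻ ω, expNeg (∫⁻ l, f l ∂η ω) ∂P = expNeg (∫⁻ l, (1 - expNeg (f l)) ∂ν) := by
  -- The level sets of `f` are numbered by `Fin` because the independence axiom is stated for
  -- families so indexed.
  let e := f.range.equivFin
  have hA : ∀ i, MeasurableSet (f ⁻¹' {((e.symm i : f.range) : ℝ≥0∞)}) := fun i =>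
    f.measurableSet_fiber _
  have hind := h.indep f.range.card (fun i => f ⁻¹' {((e.symm i : f.range) : ℝ≥0∞)}) hA
    fun i j hij => by
      refine Disjoint.preimage _ (Set.disjoint_singleton.2 fun hc => hij ?_)
      exact e.symm.injective (Subtype.ext hc)
  have hind2 := hind.comp (fun i y => expNeg ((e.symm i : ℝ≥0∞) * y))
    fun i => measurable_expNeg.comp (measurable_id.const_mul _)
  have key : ∀ (g : ℝ≥0∞ → ℝ≥0∞) (m : Measure E), ∑ c ∈ f.range, g c * m (f ⁻¹' {c}) =
      ∑ i : Fin f.range.card, g (e.symm i) * m (f ⁻¹' {((e.symm i : f.range) : ℝ≥0∞)}) := by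
    intro g m
    rw [← Finset.sum_coe_sort,
      ← e.symm.sum_comp (fun c : f.range => g c * m (f ⁻¹' {(c : ℝ≥0∞)}))]
  have h1 : ∫⁻ l, (1 - expNeg (f l)) ∂ν =
      ∑ i, (1 - expNeg (e.symm i)) * ν (f ⁻¹' {((e.symm i : f.range) : ℝ≥0∞)}) := by
    rw [← key (fun c => 1 - expNeg c), ← SimpleFunc.map_lintegral (fun c => 1 - expNeg c) f,
      ← SimpleFunc.lintegral_eq_lintegral]
    rfl
  have h2 : ∀ ω, ∫⁻ l, f l ∂η ω =
      ∑ i, (e.symm i : ℝ≥0∞) * η ω (f ⁻¹' {((e.symm i : f.range) : ℝ≥0∞)}) := by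
    intro ω
    rw [SimpleFunc.lintegral_eq_lintegral, SimpleFunc.lintegral, key (fun c => c)]
  simp_rw [h2, h1, expNeg_sum, ← h.lintegral_expNeg_mul (hA _)]
  exact lintegral_prod_eq_prod_lintegral_of_indepFun Finset.univ _ hind2 fun i =>
    measurable_expNeg.comp (((Measure.measurable_coe (hA i)).comp h.measurable).const_mul _)

/-- The Laplace functional of a Poisson process. -/
theorem lintegral_expNeg (h : IsPoissonProcess P η ν) {f : E → ℝ≥0∞} (hf : Measurable f) :
    ∫⁻ ω, expNeg (∫⁻ l, f l ∂η ω) ∂P = expNeg (∫⁻ l, (1 - expNeg (f l)) ∂ν) := by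
  have hmono : Monotone (SimpleFunc.eapprox f) := SimpleFunc.monotone_eapprox f
  have hlim : ∀ l, Filter.Tendsto (fun n => SimpleFunc.eapprox f n l) Filter.atTop (nhds (f l)) :=
    fun l => SimpleFunc.iSup_eapprox_apply hf l ▸
      tendsto_atTop_iSup fun _ _ hnm => hmono hnm l
  have h1 : Filter.Tendsto (fun n => ∫⁻ ω, expNeg (∫⁻ l, SimpleFunc.eapprox f n l ∂η ω) ∂P)
      Filter.atTop (nhds (∫⁻ ω, expNeg (∫⁻ l, f l ∂η ω) ∂P)) := by
    refine tendsto_lintegral_of_dominated_convergence (fun _ => 1) (fun n => ?_)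
      (fun n => Filter.Eventually.of_forall fun ω => expNeg_le_one _) (by simp)
      (Filter.Eventually.of_forall fun ω => ?_)
    · exact measurable_expNeg.comp
        ((Measure.measurable_lintegral (SimpleFunc.eapprox f n).measurable).comp h.measurable)
    · refine (continuous_expNeg.tendsto _).comp
        (lintegral_tendsto_of_tendsto_of_monotone
          (fun n => (SimpleFunc.eapprox f n).measurable.aemeasurable)
          (Filter.Eventually.of_forall fun l _ _ hnm => hmono hnm l)
          (Filter.Eventually.of_forall hlim))
  have h2 : Filter.Tendsto (fun n => expNeg (∫⁻ l, (1 - expNeg (SimpleFunc.eapprox f n l)) ∂ν))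
      Filter.atTop (nhds (expNeg (∫⁻ l, (1 - expNeg (f l)) ∂ν))) := by
    refine (continuous_expNeg.tendsto _).comp
      (lintegral_tendsto_of_tendsto_of_monotone
        (fun n => (measurable_const.sub
          (measurable_expNeg.comp (SimpleFunc.eapprox f n).measurable)).aemeasurable)
        (Filter.Eventually.of_forall fun l _ _ hnm =>
          tsub_le_tsub_left (expNeg_antitone (hmono hnm l)) _)
        (Filter.Eventually.of_forall fun l =>
          ENNReal.Tendsto.sub tendsto_const_nhds ((continuous_expNeg.tendsto _).comp (hlim l))
            (Or.inl ENNReal.one_ne_top)))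
  simp_rw [h.lintegral_expNeg_simpleFunc] at h1
  exact tendsto_nhds_unique h1 h2

end IsPoissonProcess

/-! ### Uniqueness of Laplace transforms on `[0, ∞]^J`. -/

/-- Finite measures on `[0, ∞]^J` are determined by their Laplace transforms at integer points. -/
theorem MeasureTheory.Measure.ext_of_lintegral_prod_expNeg_pow {J : Type*} [Fintype J]
    {μ ν : Measure (J → ℝ≥0∞)} [IsFiniteMeasure μ] [IsFiniteMeasure ν]
    (h : ∀ m : J → ℕ, ∫⁻ y, ∏ j, expNeg (y j) ^ m j ∂μ = ∫⁻ y, ∏ j, expNeg (y j) ^ m j ∂ν) :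
    μ = ν := by
  classical
  let φ : J → BoundedContinuousFunction (J → ℝ≥0∞) ℝ := fun j =>
    BoundedContinuousFunction.mkOfCompact ⟨fun y => (expNeg (y j)).toReal,
      ENNReal.continuousOn_toReal.comp_continuous
        (continuous_expNeg.comp (continuous_apply j)) fun y => expNeg_ne_top _⟩
  -- Stone–Weierstrass: the algebra generated by the functions `e^{-y_j}` separates points,
  -- including those with infinite coordinates, and it is spanned by the monomials for which the
  -- hypothesis gives equal integrals.
  let A : StarSubalgebra ℝ (BoundedContinuousFunction (J → ℝ≥0∞) ℝ) :=
    StarAlgebra.adjoin ℝ (Set.range φ)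
  have hA : (A.map (BoundedContinuousFunction.toContinuousMapStarₐ ℝ)).SeparatesPoints := by
    intro x y hxy
    obtain ⟨j, hj⟩ := Function.ne_iff.1 hxy
    refine ⟨φ j, ⟨φ j, ⟨φ j, StarAlgebra.subset_adjoin ℝ _ ⟨j, rfl⟩, rfl⟩, rfl⟩, fun he => hj ?_⟩
    exact expNeg_injective ((ENNReal.toReal_eq_toReal_iff' (expNeg_ne_top _)
      (expNeg_ne_top _)).1 he)
  refine ext_of_forall_mem_subalgebra_integral_eq_of_polish hA fun g hg => ?_
  have hstar : (StarAlgebra.adjoin ℝ (Set.range φ)).toSubalgebra =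
      Algebra.adjoin ℝ (Set.range φ) := by
    rw [StarAlgebra.adjoin_toSubalgebra]
    congr 1
    refine Set.union_eq_self_of_subset_right ?_
    rintro f ⟨j, hj⟩
    exact ⟨j, by rw [hj]; ext; simp⟩
  have hg' : g ∈ Subalgebra.toSubmodule (Algebra.adjoin ℝ (Set.range φ)) := by
    rw [← hstar]; exact hg
  rw [Algebra.adjoin_eq_span] at hg'
  clear hg
  induction hg' using Submodule.span_induction with
  | zero => simp
  | add f g _ _ hf hg =>
    simp only [BoundedContinuousFunction.coe_add, Pi.add_apply]
    rw [integral_add (f.integrable μ) (g.integrable μ),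
      integral_add (f.integrable ν) (g.integrable ν), hf, hg]
  | smul c f _ hf =>
    simp only [BoundedContinuousFunction.coe_smul, integral_smul, hf]
  | mem f hf =>
    obtain ⟨m, hm⟩ : ∃ m : J → ℕ, f = ∏ j, φ j ^ m j := by
      induction hf using Submonoid.closure_induction with
      | one => exact ⟨0, by simp⟩
      | mem f hf =>
        obtain ⟨j, rfl⟩ := hf
        exact ⟨Pi.single j 1, by simp [Pi.single_apply, pow_ite]⟩
      | mul f g _ _ hf hg =>
        obtain ⟨m, rfl⟩ := hf
        obtain ⟨n, rfl⟩ := hg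
        exact ⟨m + n, by simp [pow_add, Finset.prod_mul_distrib]⟩
    have hf' : ∀ y, f y = (∏ j, expNeg (y j) ^ m j).toReal := by
      intro y
      have hc : f y = ∏ j, (φ j y) ^ m j := by
        rw [hm]
        exact map_prod (BoundedContinuousFunction.toContinuousMapₐ ℝ |>.toRingHom.comp
          (RingHom.id _) |> fun r => (ContinuousMap.evalAlgHom ℝ ℝ y).toRingHom.comp r) _ _
          |>.trans (Finset.prod_congr rfl fun j _ => map_pow _ _ _)
      rw [hc, ENNReal.toReal_prod]
      exact Finset.prod_congr rfl fun j _ => (ENNReal.toReal_pow _ _).symm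
    have hmeas : Measurable fun y : J → ℝ≥0∞ => ∏ j, expNeg (y j) ^ m j :=
      Finset.measurable_prod _ fun j _ => (measurable_expNeg.comp (measurable_pi_apply j)).pow_const _
    have hfin : ∀ y : J → ℝ≥0∞, ∏ j, expNeg (y j) ^ m j < ∞ := fun y =>
      (ENNReal.prod_ne_top fun j _ => ENNReal.pow_ne_top (expNeg_ne_top _)).lt_top
    simp_rw [hf']
    rw [integral_toReal hmeas.aemeasurable (Filter.Eventually.of_forall hfin),
      integral_toReal hmeas.aemeasurable (Filter.Eventually.of_forall hfin), h m]

/-! ### Positive matrices: Neumann series and logarithms of determinants. -/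

section PositiveMatrix

open Matrix

variable {X : Type*} [Fintype X]

/-- A positive definite quadratic form is coercive. -/
theorem Matrix.exists_pos_forall_mul_sum_sq_le {A : Matrix X X ℝ}
    (hA : ∀ v : X → ℝ, v ≠ 0 → 0 < v ⬝ᵥ A *ᵥ v) :
    ∃ c : ℝ, 0 < c ∧ ∀ v : X → ℝ, c * ∑ x, v x ^ 2 ≤ v ⬝ᵥ A *ᵥ v := by
  let K : Set (X → ℝ) := {v | ∑ x, v x ^ 2 = 1}
  have hcont : Continuous fun v : X → ℝ => v ⬝ᵥ A *ᵥ v := by fun_prop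
  have hK : IsCompact K := by
    refine Metric.isCompact_of_isClosed_isBounded
      (isClosed_eq (by fun_prop) continuous_const) ?_
    refine (Metric.isBounded_closedBall (x := (0 : X → ℝ)) (r := 1)).subset fun v hv => ?_
    rw [mem_closedBall_zero_iff, pi_norm_le_iff_of_nonneg zero_le_one]
    intro x
    rw [Real.norm_eq_abs, ← sq_le_one_iff_abs_le_one]
    exact hv ▸ Finset.single_le_sum (f := fun x => v x ^ 2) (fun x _ => sq_nonneg _)
      (Finset.mem_univ x)
  have hne : ∀ v ∈ K, v ≠ 0 := by
    rintro v hv rfl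
    simp [K] at hv
  obtain ⟨c, hc, hcK⟩ : ∃ c : ℝ, 0 < c ∧ ∀ v ∈ K, c ≤ v ⬝ᵥ A *ᵥ v := by
    rcases K.eq_empty_or_nonempty with h | h
    · exact ⟨1, one_pos, by simp [h]⟩
    · obtain ⟨v, hv, hmin⟩ := hK.exists_isMinOn h hcont.continuousOn
      exact ⟨_, hA v (hne v hv), fun w hw => hmin hw⟩
  refine ⟨c, hc, fun v => ?_⟩
  rcases eq_or_ne v 0 with rfl | hv
  · simp
  have hpos : 0 < ∑ x, v x ^ 2 := by
    obtain ⟨x, hx⟩ := Function.ne_iff.1 hv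
    exact Finset.sum_pos' (fun x _ => sq_nonneg _) ⟨x, Finset.mem_univ x, by
      have : v x ≠ 0 := hx
      positivity⟩
  set s := ∑ x, v x ^ 2
  have hs : (√s)⁻¹ * (√s)⁻¹ = s⁻¹ := by rw [← mul_inv, Real.mul_self_sqrt hpos.le]
  have hmem : (√s)⁻¹ • v ∈ K := by
    simp only [K, Set.mem_ofPred_eq, Pi.smul_apply, smul_eq_mul, mul_pow, ← Finset.mul_sum]
    rw [pow_two, hs]
    exact inv_mul_cancel₀ hpos.ne'
  have := hcK _ hmem
  rw [mulVec_smul, smul_dotProduct, dotProduct_smul, smul_smul, hs, smul_eq_mul,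
    inv_mul_eq_div, le_div_iff₀ hpos] at this
  exact this

variable [DecidableEq X]

theorem Matrix.det_ne_zero_of_forall_dotProduct_pos {A : Matrix X X ℝ}
    (hA : ∀ v : X → ℝ, v ≠ 0 → 0 < v ⬝ᵥ A *ᵥ v) : A.det ≠ 0 := by
  intro h
  obtain ⟨v, hv, hAv⟩ := Matrix.exists_mulVec_eq_zero_iff.2 h
  have := hA v hv
  simp [hAv] at this

theorem diag_pos_of_forall_dotProduct_pos {D : X → ℝ} {S : Matrix X X ℝ} (hS : ∀ x y, 0 ≤ S x y)
    (hA : ∀ v : X → ℝ, v ≠ 0 → 0 < v ⬝ᵥ (diagonal D - S) *ᵥ v) (x : X) : 0 < D x := by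
  have := hA (Pi.single x 1) (by simp)
  simp at this
  linarith [hS x x]

/-- The Neumann series of `diagonal D - S`. -/
theorem hasSum_neumann {D : X → ℝ} {S : Matrix X X ℝ} (hS : ∀ x y, 0 ≤ S x y)
    (hA : ∀ v : X → ℝ, v ≠ 0 → 0 < v ⬝ᵥ (diagonal D - S) *ᵥ v) :
    HasSum (fun p : ℕ => (diagonal (fun x => (D x)⁻¹) * S) ^ p * diagonal (fun x => (D x)⁻¹))
      (diagonal D - S)⁻¹ := by
  have hD := diag_pos_of_forall_dotProduct_pos hS hA
  obtain ⟨c, hc, hcoer⟩ := Matrix.exists_pos_forall_mul_sum_sq_le hA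
  have hdet := Matrix.det_ne_zero_of_forall_dotProduct_pos hA
  set E : Matrix X X ℝ := diagonal fun x => (D x)⁻¹ with hE
  set T := E * S with hT
  have hT0 : ∀ x y, 0 ≤ T x y := fun x y => by
    rw [hT, hE, diagonal_mul]
    exact mul_nonneg (inv_nonneg.2 (hD x).le) (hS x y)
  have hTp : ∀ p x y, 0 ≤ (T ^ p) x y := by
    intro p
    induction p with
    | zero => intro x y; rw [pow_zero, one_apply]; split_ifs <;> norm_num
    | succ p ih =>
      intro x y
      rw [pow_succ, mul_apply]
      exact Finset.sum_nonneg fun z _ => mul_nonneg (ih x z) (hT0 z y)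
  have hDE : diagonal D * E = 1 := by
    rw [hE, diagonal_mul_diagonal, ← diagonal_one]
    congr 1; ext x; exact mul_inv_cancel₀ (hD x).ne'
  have hDT : diagonal D * T = S := by rw [hT, ← mul_assoc, hDE, one_mul]
  -- Convergence comes from coercivity rather than from a bound on the spectral radius of `T`. The
  -- partial sums `f N`, applied to the constant `1`, satisfy `f N ≤ f (N + 1) = 1 + T f N`, that is
  -- `(D - S) f N ≤ D`. Pairing with `f N` bounds them uniformly in `N`.
  let f : ℕ → X → ℝ := fun N => (∑ p ∈ Finset.range N, T ^ p) *ᵥ 1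
  have hf0 : ∀ N x, 0 ≤ f N x := fun N x => by
    simp only [f, mulVec, dotProduct, Pi.one_apply, mul_one, Matrix.sum_apply]
    exact Finset.sum_nonneg fun y _ => Finset.sum_nonneg fun p _ => hTp p x y
  have hmono : ∀ N x, f N x ≤ f (N + 1) x := fun N x => by
    simp only [f, mulVec, dotProduct, Pi.one_apply, mul_one, Matrix.sum_apply]
    refine Finset.sum_le_sum fun y _ => ?_
    rw [Finset.sum_range_succ]
    exact le_add_of_nonneg_right (hTp N x y)
  have hrec : ∀ N, f (N + 1) = 1 + T *ᵥ f N := fun N => by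
    simp only [f, Finset.sum_range_succ', pow_zero, add_mulVec, one_mulVec, mulVec_mulVec,
      Finset.mul_sum, pow_succ']
    rw [add_comm]
  have hle : ∀ N x, ((diagonal D - S) *ᵥ f N) x ≤ D x := by
    intro N x
    have h1 := hmono N x
    rw [hrec] at h1
    have h2 := mul_le_mul_of_nonneg_left h1 (hD x).le
    have h3 : D x * (T *ᵥ f N) x = (S *ᵥ f N) x := by
      rw [← mulVec_diagonal, mulVec_mulVec, hDT]
    rw [sub_mulVec, Pi.sub_apply, mulVec_diagonal]
    simp only [Pi.add_apply, Pi.one_apply, mul_add, h3] at h2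
    linarith
  have hbound : ∀ N, ∑ x, f N x ^ 2 ≤ (∑ x, D x ^ 2) / c ^ 2 := by
    intro N
    -- Young's inequality `f D ≤ (c/2) f² + D²/(2c)`, with the weight chosen so that half of the
    -- coercive term survives.
    have h1 : f N ⬝ᵥ (diagonal D - S) *ᵥ f N ≤ ∑ x, (c / 2 * f N x ^ 2 + D x ^ 2 / (2 * c)) := by
      refine Finset.sum_le_sum fun x _ => (mul_le_mul_of_nonneg_left (hle N x) (hf0 N x)).trans ?_
      have : 0 ≤ (c * f N x - D x) ^ 2 / (2 * c) := by positivity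
      have h : (c * f N x - D x) ^ 2 / (2 * c) =
        c / 2 * f N x ^ 2 + D x ^ 2 / (2 * c) - f N x * D x := by field_simp; ring
      linarith
    rw [Finset.sum_add_distrib, ← Finset.mul_sum, ← Finset.sum_div] at h1
    have h2 := (hcoer (f N)).trans h1
    rw [le_div_iff₀ (by positivity)]
    have h3 : c / 2 * ∑ x, f N x ^ 2 ≤ (∑ x, D x ^ 2) / (2 * c) := by linarith
    rw [le_div_iff₀ (by positivity)] at h3
    linarith
  have hsummable : Summable fun p : ℕ => T ^ p := by
    refine Pi.summable.2 fun x => Pi.summable.2 fun y => ?_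
    refine summable_of_sum_range_le (c := √((∑ x, D x ^ 2) / c ^ 2)) (fun p => hTp p x y) fun N => ?_
    have h1 : ∑ p ∈ Finset.range N, (T ^ p) x y ≤ f N x := by
      simp only [f, mulVec, dotProduct, Pi.one_apply, mul_one, Matrix.sum_apply]
      exact Finset.single_le_sum (f := fun y => ∑ p ∈ Finset.range N, (T ^ p) x y)
        (fun y _ => Finset.sum_nonneg fun p _ => hTp p x y) (Finset.mem_univ y)
    refine h1.trans (Real.le_sqrt_of_sq_le ((Finset.single_le_sum (f := fun x => f N x ^ 2)
      (fun x _ => sq_nonneg _) (Finset.mem_univ x)).trans (hbound N)))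
  have hinv : (diagonal D - S) * ((∑' p : ℕ, T ^ p) * E) = 1 := by
    have h3 : diagonal D - S = diagonal D * (1 - T) := by rw [mul_sub, mul_one, hDT]
    rw [h3, mul_assoc, ← mul_assoc (1 - T), hsummable.one_sub_mul_tsum_pow, one_mul, hDE]
  rw [Matrix.inv_eq_right_inv hinv]
  exact hsummable.hasSum.mul_right E

/-- Jacobi's formula. Factoring out the determinant at `r` reduces it to the expansion `det (1 + εM)
= 1 + ε tr M + O(ε²)`. -/
theorem hasDerivAt_log_det_add_smul {A L : Matrix X X ℝ} {r : ℝ} (h : (A + r • L).det ≠ 0) :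
    HasDerivAt (fun r : ℝ => Real.log (A + r • L).det) (((A + r • L)⁻¹ * L).trace) r := by
  set B := A + r • L with hB
  have hu : IsUnit B.det := isUnit_iff_ne_zero.2 h
  have h1 : ∀ t : ℝ, (A + t • L).det = B.det * (1 + (t - r) • (B⁻¹ * L)).det := by
    intro t
    rw [← det_mul, mul_add, mul_one, mul_smul_comm, ← mul_assoc, mul_nonsing_inv _ hu, one_mul, hB,
      add_assoc, ← add_smul]
    congr 3; ring
  have h2 : HasDerivAt (fun t : ℝ => (A + t • L).det) (B.det * (B⁻¹ * L).trace) r := by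
    rw [funext fun t => (h1 t).trans (by rw [det_one_add_smul])]
    have hq : HasDerivAt (fun t : ℝ => t - r) 1 r := (hasDerivAt_id r).sub_const r
    have hp := ((det (1 + (Polynomial.X : Polynomial ℝ) •
      (B⁻¹ * L).map Polynomial.C)).divX.divX.hasDerivAt (r - r)).comp (h := fun t : ℝ => t - r) r hq
    convert! ((((hq.const_mul (B⁻¹ * L).trace).const_add 1).add (hp.mul (hq.pow 2))).const_mul
      B.det) using 1
    simp
  convert! h2.log (by simpa [← hB] using h) using 1
  rw [← hB]
  field_simp

/-- Each determinant is `r^n det (diagonal l)` times a factor tending to `1`, so the leading terms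
cancel. This is the boundary value at infinity when the resolvent traces are integrated. -/
theorem tendsto_log_det_add_smul_sub {A B : Matrix X X ℝ} {l : X → ℝ} (hl : ∀ x, 0 < l x) :
    Filter.Tendsto (fun r : ℝ => Real.log (A + r • diagonal l).det -
      Real.log (B + r • diagonal l).det) Filter.atTop (nhds 0) := by
  have hld : (diagonal l).det ≠ 0 := by
    rw [det_diagonal]; exact (Finset.prod_pos fun x _ => hl x).ne'
  have hu : IsUnit (diagonal l).det := isUnit_iff_ne_zero.2 hld
  let φ : Matrix X X ℝ → ℝ → ℝ := fun A r => (1 + r⁻¹ • ((diagonal l)⁻¹ * A)).det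
  have hφ : ∀ A, Filter.Tendsto (φ A) Filter.atTop (nhds 1) := by
    intro A
    have hc : Continuous fun s : ℝ => (1 + s • ((diagonal l)⁻¹ * A)).det := by fun_prop
    have := (hc.tendsto 0).comp tendsto_inv_atTop_zero
    simpa [Function.comp_def] using this
  have hlog : ∀ A, Filter.Tendsto (fun r => Real.log (φ A r)) Filter.atTop (nhds 0) := fun A => by
    simpa using (hφ A).log one_ne_zero
  have hfac : ∀ A (r : ℝ), r ≠ 0 → (A + r • diagonal l).det = (r • diagonal l).det * φ A r := by
    intro A r hr
    rw [← det_mul, mul_add, mul_one, smul_mul_smul_comm, mul_inv_cancel₀ hr, one_smul, ← mul_assoc,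
      mul_nonsing_inv _ hu, one_mul, add_comm]
  have hne : ∀ A, ∀ᶠ r in Filter.atTop, φ A r ≠ 0 := fun A => (hφ A).eventually_ne one_ne_zero
  have := (hlog A).sub (hlog B)
  rw [sub_zero] at this
  refine this.congr' ?_
  filter_upwards [hne A, hne B, Filter.eventually_gt_atTop 0] with r h1 h2 hr
  have h3 : (r • diagonal l).det ≠ 0 := by
    rw [det_smul]; exact mul_ne_zero (pow_ne_zero _ hr.ne') hld
  rw [hfac A r hr.ne', hfac B r hr.ne', Real.log_mul h3 h1, Real.log_mul h3 h2]
  ring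

theorem dotProduct_add_smul_diagonal_pos {A : Matrix X X ℝ}
    (hA : ∀ v : X → ℝ, v ≠ 0 → 0 < v ⬝ᵥ A *ᵥ v) {l : X → ℝ} (hl : ∀ x, 0 < l x) {r : ℝ}
    (hr : 0 ≤ r) (v : X → ℝ) (hv : v ≠ 0) : 0 < v ⬝ᵥ (A + r • diagonal l) *ᵥ v := by
  rw [add_mulVec, dotProduct_add, smul_mulVec, dotProduct_smul]
  refine add_pos_of_pos_of_nonneg (hA v hv) (mul_nonneg hr (Finset.sum_nonneg fun x _ => ?_))
  rw [mulVec_diagonal]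
  nlinarith [hl x, mul_self_nonneg (v x), mul_nonneg (hl x).le (mul_self_nonneg (v x))]

/-- Integration of the difference of two resolvent traces. -/
theorem lintegral_trace_resolvent_sub {A B : Matrix X X ℝ}
    (hA : ∀ v : X → ℝ, v ≠ 0 → 0 < v ⬝ᵥ A *ᵥ v) (hB : ∀ v : X → ℝ, v ≠ 0 → 0 < v ⬝ᵥ B *ᵥ v)
    {l : X → ℝ} (hl : ∀ x, 0 < l x)
    (hle : ∀ r : ℝ, 0 < r → ((B + r • diagonal l)⁻¹ * diagonal l).trace ≤
      ((A + r • diagonal l)⁻¹ * diagonal l).trace) :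
    Real.log A.det ≤ Real.log B.det ∧ ∫⁻ r in Set.Ioi (0 : ℝ), ENNReal.ofReal (((A + r • diagonal l)⁻¹ * diagonal l).trace -
        ((B + r • diagonal l)⁻¹ * diagonal l).trace) =
      ENNReal.ofReal (Real.log B.det - Real.log A.det) := by
  -- The integrand is the derivative of a function that tends to `0` at infinity and equals `log det
  -- A - log det B` at `0`. Its nonnegativity yields integrability and the inequality of the two
  -- logarithms.
  have hd : ∀ r ∈ Set.Ici (0 : ℝ), HasDerivAt (fun r : ℝ => Real.log (A + r • diagonal l).det -
      Real.log (B + r • diagonal l).det) (((A + r • diagonal l)⁻¹ * diagonal l).trace -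
        ((B + r • diagonal l)⁻¹ * diagonal l).trace) r := fun r hr =>
    (hasDerivAt_log_det_add_smul (Matrix.det_ne_zero_of_forall_dotProduct_pos
      (dotProduct_add_smul_diagonal_pos hA hl hr))).sub
    (hasDerivAt_log_det_add_smul (Matrix.det_ne_zero_of_forall_dotProduct_pos
      (dotProduct_add_smul_diagonal_pos hB hl hr)))
  have hpos : ∀ r ∈ Set.Ioi (0 : ℝ), 0 ≤ ((A + r • diagonal l)⁻¹ * diagonal l).trace -
        ((B + r • diagonal l)⁻¹ * diagonal l).trace := fun r hr => sub_nonneg.2 (hle r hr)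
  have hint := integrableOn_Ioi_deriv_of_nonneg' hd hpos (tendsto_log_det_add_smul_sub hl)
  have hval := integral_Ioi_of_hasDerivAt_of_nonneg' hd hpos (tendsto_log_det_add_smul_sub hl)
  refine ⟨?_, ?_⟩
  · have h := setIntegral_nonneg (μ := volume) measurableSet_Ioi hpos
    rw [hval] at h
    simpa using h
  rw [← ofReal_integral_eq_lintegral_ofReal hint
    ((ae_restrict_iff' measurableSet_Ioi).2 (Filter.Eventually.of_forall hpos)), hval]
  simp

end PositiveMatrix

/-! ### Real and complex Gaussian integrals. -/

section Gaussian

open Matrix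

theorem integrable_exp_neg_mul_sum_norm_sq {X 𝕂 : Type*} [Fintype X] [NormedAddCommGroup 𝕂]
    [InnerProductSpace ℝ 𝕂] [FiniteDimensional ℝ 𝕂] [MeasurableSpace 𝕂] [BorelSpace 𝕂]
    {c : ℝ} (hc : 0 < c) :
    Integrable fun z : X → 𝕂 => Real.exp (-(c * ∑ x, ‖z x‖ ^ 2)) := by
  have h1 : Integrable fun z : 𝕂 => Real.exp (-c * ‖z‖ ^ 2) := by
    have h := (GaussianFourier.integrable_cexp_neg_mul_sq_norm_add (V := 𝕂) (b := c)
      (by simpa using hc) 0 0).re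
    refine h.congr (Filter.Eventually.of_forall fun z => ?_)
    have : (-(c : ℂ) * (‖z‖ : ℂ) ^ 2 + 0 * ((inner ℝ (0 : 𝕂) z : ℝ) : ℂ)) =
      ((-c * ‖z‖ ^ 2 : ℝ) : ℂ) := by push_cast; ring
    simp only [this, RCLike.re_to_complex]
    exact Complex.exp_ofReal_re _
  convert! Integrable.fintype_prod (ι := X) (f := fun _ z => Real.exp (-c * ‖z‖ ^ 2))
    (μ := fun _ => (volume : Measure 𝕂)) (fun _ => h1) using 2 with z
  rw [← Real.exp_sum, ← Finset.mul_sum, neg_mul]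

theorem Matrix.posDef_of_forall_dotProduct_pos {X : Type*} [Fintype X] {S : Matrix X X ℝ}
    (hs : S.IsSymm)
    (h : ∀ v : X → ℝ, v ≠ 0 → 0 < v ⬝ᵥ S *ᵥ v) : S.PosDef :=
  .of_dotProduct_mulVec_pos (by rwa [IsHermitian, conjTranspose_eq_transpose_of_trivial])
    fun v hv => by simpa using h v hv

variable {X : Type*} [Fintype X] [DecidableEq X]

/-- The Fourier transform of a Gaussian density, in terms of its matrix. -/
theorem integral_cexp_neg_dotProduct_add {S : Matrix X X ℝ} (hS : S.PosDef) (c : X → ℝ) :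
    ∫ v : X → ℝ, Complex.exp (-((v ⬝ᵥ S *ᵥ v : ℝ) : ℂ) + Complex.I * ((c ⬝ᵥ v : ℝ) : ℂ)) =
      ((√Real.pi ^ Fintype.card X / √S.det * Real.exp (-(c ⬝ᵥ S⁻¹ *ᵥ c) / 4) : ℝ) : ℂ) := by
  -- With `S = BᵀB` and `w = Bv` the integral becomes a product of one-dimensional ones; the vector
  -- `d` below satisfies `c · v = d · Bv`.
  obtain ⟨B, hB⟩ : ∃ B : Matrix X X ℝ, S = Bᵀ * B := by
    open scoped MatrixOrder Matrix.Norms.L2Operator in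
    obtain ⟨B, hB⟩ := CStarAlgebra.nonneg_iff_eq_star_mul_self.mp hS.posSemidef.nonneg
    exact ⟨B, by rw [hB, star_eq_conjTranspose, conjTranspose_eq_transpose_of_trivial]⟩
  have hdetS : S.det = B.det ^ 2 := by rw [hB, det_mul, det_transpose, sq]
  have hdet : B.det ≠ 0 := by
    intro h
    have := hS.det_pos
    rw [hdetS, h] at this
    norm_num at this
  have hu : IsUnit B.det := isUnit_iff_ne_zero.2 hdet
  set d : X → ℝ := (B⁻¹)ᵀ *ᵥ c with hd
  let g : (X → ℝ) → ℂ := fun w =>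
    Complex.exp (-1 * ∑ i, (w i : ℂ) ^ 2 + ∑ i, (Complex.I * d i) * w i)
  have h1 : ∀ v : X → ℝ,
      Complex.exp (-((v ⬝ᵥ S *ᵥ v : ℝ) : ℂ) + Complex.I * ((c ⬝ᵥ v : ℝ) : ℂ)) = g (B *ᵥ v) := by
    intro v
    have e1 : v ⬝ᵥ S *ᵥ v = ∑ i, (B *ᵥ v) i ^ 2 := by
      rw [hB, ← mulVec_mulVec, dotProduct_mulVec, vecMul_transpose]
      exact Finset.sum_congr rfl fun i _ => (sq _).symm
    have e2 : c ⬝ᵥ v = ∑ i, d i * (B *ᵥ v) i := by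
      change _ = d ⬝ᵥ B *ᵥ v
      rw [hd, mulVec_transpose, dotProduct_mulVec, vecMul_vecMul, nonsing_inv_mul _ hu, vecMul_one]
    simp only [g]
    rw [e1, e2]
    push_cast
    rw [Finset.mul_sum]
    simp only [neg_mul, one_mul, mul_assoc]
  have h2 : ∫ v : X → ℝ, g (B *ᵥ v) = |B.det|⁻¹ • ∫ w, g w := by
    have hm := Real.map_matrix_volume_pi_eq_smul_volume_pi hdet
    have hcont : Continuous g := by fun_prop
    have hmv : Measurable (toLin' B) := (LinearMap.continuous_of_finiteDimensional _).measurable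
    have := integral_map (μ := volume) hmv.aemeasurable
      (hcont.aestronglyMeasurable (μ := Measure.map (toLin' B) volume))
    rw [hm, integral_smul_measure, ENNReal.toReal_ofReal (abs_nonneg _), abs_inv] at this
    rw [this]
    rfl
  have h3 : ∑ i, (Complex.I * (d i : ℂ)) ^ 2 = ((-(c ⬝ᵥ S⁻¹ *ᵥ c) : ℝ) : ℂ) := by
    have e : c ⬝ᵥ S⁻¹ *ᵥ c = ∑ i, d i ^ 2 := by
      rw [hB, Matrix.mul_inv_rev, ← mulVec_mulVec, dotProduct_mulVec, ← mulVec_transpose,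
        ← transpose_nonsing_inv]
      exact Finset.sum_congr rfl fun i _ => (sq _).symm
    rw [e]
    push_cast
    simp [mul_pow, Finset.sum_neg_distrib]
  simp_rw [h1]
  rw [h2, GaussianFourier.integral_cexp_neg_mul_sum_add (by simp), h3, hdetS, Real.sqrt_sq_eq_abs]
  have h4 : ((Real.pi : ℂ) / 1) ^ (Fintype.card X / 2 : ℂ) =
      ((√Real.pi ^ Fintype.card X : ℝ) : ℂ) := by
    rw [div_one, Real.sqrt_eq_rpow, ← Real.rpow_natCast, ← Real.rpow_mul Real.pi_pos.le,
      Complex.ofReal_cpow Real.pi_pos.le]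
    push_cast
    congr 1
    ring
  rw [h4, Complex.real_smul]
  push_cast
  ring_nf

theorem integral_exp_neg_dotProduct {S : Matrix X X ℝ} (hS : S.PosDef) :
    ∫ v : X → ℝ, Real.exp (-(v ⬝ᵥ S *ᵥ v)) = √Real.pi ^ Fintype.card X / √S.det := by
  have h := integral_cexp_neg_dotProduct_add hS 0
  simp only [zero_dotProduct, Complex.ofReal_zero, mul_zero, add_zero, neg_zero, zero_div,
    Real.exp_zero, mul_one] at h
  have : ∀ v : X → ℝ, Complex.exp (-((v ⬝ᵥ S *ᵥ v : ℝ) : ℂ)) =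
      ((Real.exp (-(v ⬝ᵥ S *ᵥ v)) : ℝ) : ℂ) := fun v => by push_cast; rfl
  simp_rw [this, integral_complex_ofReal] at h
  exact_mod_cast h

/-- The complex Gaussian integral with a real, not necessarily symmetric, matrix. -/
theorem integral_cexp_neg_sesquilinear {A : Matrix X X ℝ}
    (hA : ∀ v : X → ℝ, v ≠ 0 → 0 < v ⬝ᵥ A *ᵥ v) :
    ∫ z : X → ℂ, Complex.exp (-∑ x, ∑ y, (A x y : ℂ) * (z x * star (z y))) =
      ((Real.pi ^ Fintype.card X / |A.det| : ℝ) : ℂ) := by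
  -- For `z = a + ib` the exponent is `a·Sa + b·Sb` plus an imaginary term bilinear in `a` and `b`
  -- that involves only the antisymmetric part `K`. Integrating over `b` is thus a Fourier transform
  -- at `-2Ka`, and leaves a Gaussian in `a`.
  set S : Matrix X X ℝ := (2⁻¹ : ℝ) • (A + Aᵀ) with hSdef
  set K : Matrix X X ℝ := (2⁻¹ : ℝ) • (A - Aᵀ) with hKdef
  have hT : ∀ v w : X → ℝ, v ⬝ᵥ Aᵀ *ᵥ w = w ⬝ᵥ A *ᵥ v := fun v w => by
    rw [dotProduct_mulVec, vecMul_transpose, dotProduct_comm]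
  have hquad : ∀ v : X → ℝ, v ⬝ᵥ S *ᵥ v = v ⬝ᵥ A *ᵥ v := fun v => by
    rw [hSdef, smul_mulVec, dotProduct_smul, add_mulVec, dotProduct_add, hT, smul_eq_mul]; ring
  have hSsymm : S.IsSymm := by
    rw [hSdef, IsSymm, transpose_smul, transpose_add, transpose_transpose, add_comm]
  have hS : S.PosDef := Matrix.posDef_of_forall_dotProduct_pos hSsymm fun v hv => by
    rw [hquad]; exact hA v hv
  have hdetA := Matrix.det_ne_zero_of_forall_dotProduct_pos hA
  have huS : IsUnit S.det := isUnit_iff_ne_zero.2 hS.det_pos.ne'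
  have hASK : A = S + K := by rw [hSdef, hKdef, ← smul_add]; ext x y; simp; ring
  have hK0 : ∀ v : X → ℝ, v ⬝ᵥ K *ᵥ v = 0 := fun v => by
    rw [hKdef, smul_mulVec, dotProduct_smul, sub_mulVec, dotProduct_sub, hT, sub_self, smul_zero]
  have hS' : (Aᵀ * S⁻¹ * A).PosDef := by
    have h := hS.inv.conjTranspose_mul_mul_same (B := A)
      (mulVec_injective_iff_isUnit.2 ((isUnit_iff_isUnit_det _).2 (isUnit_iff_ne_zero.2 hdetA)))
    rwa [conjTranspose_eq_transpose_of_trivial] at h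
  -- Expand `(Aa)·S⁻¹(Aa)` with `A = S + K`: the cross terms are `a·Ka = 0`. The remaining Gaussian
  -- in `a` has determinant `(det A)²/det S`, so `det S` cancels at the end.
  have hquad' : ∀ a : X → ℝ, a ⬝ᵥ S *ᵥ a + (K *ᵥ a) ⬝ᵥ S⁻¹ *ᵥ (K *ᵥ a) =
      a ⬝ᵥ (Aᵀ * S⁻¹ * A) *ᵥ a := by
    intro a
    have e1 : a ⬝ᵥ (Aᵀ * S⁻¹ * A) *ᵥ a = (A *ᵥ a) ⬝ᵥ S⁻¹ *ᵥ (A *ᵥ a) := by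
      rw [← mulVec_mulVec, ← mulVec_mulVec, dotProduct_mulVec, vecMul_transpose]
    have e2 : S⁻¹ *ᵥ (S *ᵥ a) = a := by rw [mulVec_mulVec, nonsing_inv_mul _ huS, one_mulVec]
    have e3 : (S *ᵥ a) ⬝ᵥ S⁻¹ *ᵥ (K *ᵥ a) = a ⬝ᵥ K *ᵥ a := by
      rw [dotProduct_mulVec, ← mulVec_transpose, transpose_nonsing_inv, hSsymm, e2]
    rw [e1]
    conv_rhs => rw [hASK]
    rw [add_mulVec, mulVec_add, e2, add_dotProduct, dotProduct_add, dotProduct_add, e3, hK0,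
      dotProduct_comm (S *ᵥ a), dotProduct_comm (K *ᵥ a) a, hK0]
    ring
  obtain ⟨c, hc, hcoer⟩ := Matrix.exists_pos_forall_mul_sum_sq_le hA
  let e : (X → ℂ) ≃ᵐ (X → ℝ) × (X → ℝ) :=
    (MeasurableEquiv.piCongrRight fun _ => Complex.measurableEquivRealProd).trans
      (MeasurableEquiv.arrowProdEquivProdArrow ℝ ℝ X)
  have he : MeasurePreserving e :=
    (volume_measurePreserving_arrowProdEquivProdArrow ℝ ℝ X).comp
      (volume_preserving_pi fun _ => Complex.volume_preserving_equiv_real_prod)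
  let G : (X → ℝ) × (X → ℝ) → ℂ := fun q =>
    Complex.exp (-((q.1 ⬝ᵥ S *ᵥ q.1 : ℝ) : ℂ)) * Complex.exp (-((q.2 ⬝ᵥ S *ᵥ q.2 : ℝ) : ℂ) +
      Complex.I * (((-(2 : ℝ)) • (K *ᵥ q.1) ⬝ᵥ q.2 : ℝ) : ℂ))
  have hG : ∀ z : X → ℂ,
      Complex.exp (-∑ x, ∑ y, (A x y : ℂ) * (z x * star (z y))) = G (e z) := by
    intro z
    have e0 : e z = (fun x => (z x).re, fun x => (z x).im) := rfl
    rw [e0]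
    set a : X → ℝ := fun x => (z x).re
    set b : X → ℝ := fun x => (z x).im
    have e1 : ∑ x, ∑ y, (A x y : ℂ) * (z x * star (z y)) =
        ((a ⬝ᵥ A *ᵥ a + b ⬝ᵥ A *ᵥ b : ℝ) : ℂ) +
          Complex.I * ((b ⬝ᵥ A *ᵥ a - a ⬝ᵥ A *ᵥ b : ℝ) : ℂ) := by
      simp only [dotProduct, mulVec, Finset.mul_sum, ← Finset.sum_add_distrib,
        ← Finset.sum_sub_distrib, Complex.ofReal_sum]
      refine Finset.sum_congr rfl fun x _ => Finset.sum_congr rfl fun y _ => ?_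
      apply Complex.ext <;> simp [a, b] <;> ring
    have e2 : (-(2 : ℝ)) • (K *ᵥ a) ⬝ᵥ b = -(b ⬝ᵥ A *ᵥ a - a ⬝ᵥ A *ᵥ b) := by
      rw [hKdef, smul_dotProduct, smul_mulVec, smul_dotProduct, sub_mulVec, sub_dotProduct,
        dotProduct_comm, dotProduct_comm _ b, hT]
      simp only [smul_eq_mul]; ring
    simp only [G]
    rw [e1, e2, hquad, hquad, ← Complex.exp_add]
    congr 1
    push_cast
    ring
  have hGint : Integrable G := by
    have hcont : Continuous G := by fun_prop
    have h1 := (integrable_exp_neg_mul_sum_norm_sq (X := X) (𝕂 := ℝ) hc).mul_prod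
      (integrable_exp_neg_mul_sum_norm_sq (X := X) (𝕂 := ℝ) hc)
    refine h1.mono' hcont.aestronglyMeasurable (Filter.Eventually.of_forall fun q => ?_)
    simp only [G, norm_mul, Complex.norm_exp]
    simp only [Real.norm_eq_abs, sq_abs]
    refine mul_le_mul (Real.exp_le_exp.2 ?_) (Real.exp_le_exp.2 ?_) (Real.exp_pos _).le
      (Real.exp_pos _).le
    · simpa [hquad] using hcoer q.1
    · simpa [hquad] using hcoer q.2
  simp_rw [hG]
  rw [he.integral_comp' G, Measure.volume_eq_prod, integral_prod G hGint]
  have h2 : ∀ a : X → ℝ, ∫ b, G (a, b) = ((√Real.pi ^ Fintype.card X / √S.det *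
      Real.exp (-(a ⬝ᵥ (Aᵀ * S⁻¹ * A) *ᵥ a)) : ℝ) : ℂ) := by
    intro a
    simp only [G]
    rw [integral_const_mul, integral_cexp_neg_dotProduct_add hS, ← hquad']
    simp only [smul_dotProduct, mulVec_smul, dotProduct_smul, smul_eq_mul]
    rw [← Complex.ofReal_neg, ← Complex.ofReal_exp, ← Complex.ofReal_mul, neg_add, Real.exp_add]
    congr 1
    have : -(-2 * (-2 * K *ᵥ a ⬝ᵥ S⁻¹ *ᵥ K *ᵥ a)) / 4 = -(K *ᵥ a ⬝ᵥ S⁻¹ *ᵥ K *ᵥ a) := by ring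
    rw [this]; ring
  simp_rw [h2, integral_complex_ofReal, integral_const_mul, integral_exp_neg_dotProduct hS']
  congr 1
  have hd : (Aᵀ * S⁻¹ * A).det = A.det ^ 2 / S.det := by
    rw [det_mul, det_mul, det_transpose, det_nonsing_inv, Ring.inverse_eq_inv']; ring
  rw [hd, Real.sqrt_div (sq_nonneg _), Real.sqrt_sq_eq_abs]
  have h3 : √S.det ≠ 0 := (Real.sqrt_pos.2 hS.det_pos).ne'
  have h4 : |A.det| ≠ 0 := abs_ne_zero.2 hdetA
  have h5 : Real.pi = √Real.pi * √Real.pi := (Real.mul_self_sqrt Real.pi_pos.le).symm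
  conv_rhs => rw [h5, mul_pow]
  field_simp

end Gaussian

/-! ### Expansion of Gaussian integrals along Poisson edge numbers. -/

section SpinExpansion

open Matrix

theorem hasSum_integral_pow_poissonMeasure (c : ℝ≥0) (w : ℂ) :
    Integrable (fun k : ℕ => w ^ k) (poissonMeasure c) ∧
      ∫ k : ℕ, w ^ k ∂poissonMeasure c = Complex.exp (-c) * Complex.exp (c * w) := by
  have hterm : ∀ k : ℕ, (Real.exp (-c) * c ^ k / k.factorial) • w ^ k =
      Complex.exp (-c) * ((c * w) ^ k / k.factorial) := fun k => by
    rw [Complex.real_smul, mul_pow]; push_cast; ring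
  have hi : Integrable (fun k : ℕ => w ^ k) (poissonMeasure c) := by
    rw [integrable_poissonMeasure_iff]
    have h := ((NormedSpace.norm_expSeries_div_summable ((c : ℂ) * w))).mul_left
      (Real.exp (-c))
    refine h.congr fun k => ?_
    rw [norm_div, norm_pow, norm_mul, norm_pow, Complex.norm_natCast, mul_pow]
    simp
    ring
  refine ⟨hi, ?_⟩
  have h := ((NormedSpace.expSeries_div_hasSum_exp ((c : ℂ) * w)).mul_left
    (Complex.exp (-c))).tsum_eq
  rw [← Complex.exp_eq_exp_ℂ] at h
  rw [integral_poissonMeasure' hi, ← h]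
  exact tsum_congr fun k => hterm k

theorem integral_prod_pow_pi_poissonMeasure {J : Type*} [Fintype J] (C : J → ℝ≥0) (w : J → ℂ) :
    Integrable (fun n : J → ℕ => ∏ e, w e ^ n e) (Measure.pi fun e => poissonMeasure (C e)) ∧
      ∫ n : J → ℕ, ∏ e, w e ^ n e ∂Measure.pi (fun e => poissonMeasure (C e)) =
        Complex.exp (-∑ e, (C e : ℂ)) * Complex.exp (∑ e, C e * w e) := by
  refine ⟨Integrable.fintype_prod_dep (f := fun (e : J) (k : ℕ) => w e ^ k) fun e =>
    (hasSum_integral_pow_poissonMeasure _ _).1, ?_⟩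
  rw [integral_fintype_prod_eq_prod (fun (e : J) (k : ℕ) => w e ^ k)]
  simp_rw [(hasSum_integral_pow_poissonMeasure _ _).2]
  rw [Finset.prod_mul_distrib, ← Complex.exp_sum, ← Complex.exp_sum, Finset.sum_neg_distrib]

variable {X : Type*} [Fintype X]

/-- The number of jumps out of `x`. -/
def outDeg (n : X × X → ℕ) (x : X) : ℕ := ∑ y, n (x, y)

/-- The number of jumps into `x`. -/
def inDeg (n : X × X → ℕ) (x : X) : ℕ := ∑ y, n (y, x)

/-- Regroups the factors by vertices: an edge contributes `f` at its tail and `g` at its head. This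
is what turns edge monomials in the spins into moments of single spins. -/
theorem prod_pow_eq_prod_outDeg_inDeg {M : Type*} [CommMonoid M] (n : X × X → ℕ) (f g : X → M) :
    ∏ e : X × X, (f e.1 * g e.2) ^ n e = ∏ x, f x ^ outDeg n x * g x ^ inDeg n x := by
  simp_rw [mul_pow, Finset.prod_mul_distrib]
  congr 1
  · rw [Fintype.prod_prod_type]
    exact Finset.prod_congr rfl fun x _ => Finset.prod_pow_eq_pow_sum _ (fun y => n (x, y)) (f x)
  · rw [Fintype.prod_prod_type_right]
    exact Finset.prod_congr rfl fun x _ => Finset.prod_pow_eq_pow_sum _ (fun y => n (y, x)) (g x)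

/-- Half of the exponent absorbs the polynomial, by `t^k / k! ≤ e^t`. -/
theorem integrable_sq_pow_mul_exp_neg {𝕂 : Type*} [NormedAddCommGroup 𝕂]
    [InnerProductSpace ℝ 𝕂] [FiniteDimensional ℝ 𝕂] [MeasurableSpace 𝕂] [BorelSpace 𝕂]
    (k : ℕ) {c : ℝ} (hc : 0 < c) :
    Integrable fun z : 𝕂 => (‖z‖ ^ 2) ^ k * Real.exp (-(c * ‖z‖ ^ 2)) := by
  have h1 : Integrable fun z : 𝕂 => Real.exp (-(c / 2 * ‖z‖ ^ 2)) := by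
    have h := (GaussianFourier.integrable_cexp_neg_mul_sq_norm_add (V := 𝕂) (b := (c / 2 : ℝ))
      (by simpa using hc) 0 0).re
    refine h.congr (Filter.Eventually.of_forall fun z => ?_)
    have : (-((c / 2 : ℝ) : ℂ) * (‖z‖ : ℂ) ^ 2 + 0 * ((inner ℝ (0 : 𝕂) z : ℝ) : ℂ)) =
      ((-(c / 2 * ‖z‖ ^ 2) : ℝ) : ℂ) := by push_cast; ring
    simp only [this, RCLike.re_to_complex]
    exact Complex.exp_ofReal_re _
  refine (h1.const_mul (k.factorial * (2 / c) ^ k)).mono'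
    (by fun_prop) (Filter.Eventually.of_forall fun z => ?_)
  rw [Real.norm_of_nonneg (by positivity)]
  have h2 := Real.pow_div_factorial_le_exp (c / 2 * ‖z‖ ^ 2) (by positivity) k
  rw [div_le_iff₀ (by positivity)] at h2
  have h3 : (‖z‖ ^ 2) ^ k = (2 / c) ^ k * (c / 2 * ‖z‖ ^ 2) ^ k := by
    rw [← mul_pow]; congr 1; field_simp
  have h4 : Real.exp (-(c * ‖z‖ ^ 2)) =
      Real.exp (-(c / 2 * ‖z‖ ^ 2)) * Real.exp (-(c / 2 * ‖z‖ ^ 2)) := by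
    rw [← Real.exp_add]; congr 1; ring
  have h5 : Real.exp (c / 2 * ‖z‖ ^ 2) * Real.exp (-(c / 2 * ‖z‖ ^ 2)) = 1 := by
    rw [← Real.exp_add]; simp
  calc (‖z‖ ^ 2) ^ k * Real.exp (-(c * ‖z‖ ^ 2))
      ≤ (2 / c) ^ k * (Real.exp (c / 2 * ‖z‖ ^ 2) * k.factorial) * Real.exp (-(c * ‖z‖ ^ 2)) := by
        rw [h3]; gcongr
    _ = k.factorial * (2 / c) ^ k * (Real.exp (c / 2 * ‖z‖ ^ 2) * Real.exp (-(c / 2 * ‖z‖ ^ 2))) *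
        Real.exp (-(c / 2 * ‖z‖ ^ 2)) := by rw [h4]; ring
    _ = _ := by rw [h5, mul_one]

variable [DecidableEq X]

/-- The expansion of a Gaussian integral in powers of its off-diagonal entries. -/
theorem lintegral_spin_expansion {𝕂 : Type*} [NormedAddCommGroup 𝕂]
    [InnerProductSpace ℝ 𝕂] [FiniteDimensional ℝ 𝕂] [MeasurableSpace 𝕂] [BorelSpace 𝕂]
    {ζ : 𝕂 → ℂ} (hζ : Continuous ζ) (hζn : ∀ z, ‖ζ z‖ = ‖z‖) {κ : ℕ → ℕ → ℝ → ℝ}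
    (hκ0 : ∀ a b l, 0 ≤ l → 0 ≤ κ a b l)
    (hκi : ∀ a b c, 0 < c →
      Integrable fun z : 𝕂 => κ a b (‖z‖ ^ 2) * Real.exp (-(c * ‖z‖ ^ 2)))
    (hκ : ∀ a b c, 0 < c →
      ∫ z : 𝕂, ζ z ^ a * star (ζ z) ^ b * (Real.exp (-(c * ‖z‖ ^ 2)) : ℂ) =
        ((∫ z : 𝕂, κ a b (‖z‖ ^ 2) * Real.exp (-(c * ‖z‖ ^ 2)) : ℝ) : ℂ))
    {C : X → X → ℝ≥0} {s : X → X → ℝ} (hs : ∀ x y, 0 ≤ s x y) {D : X → ℝ} {A : Matrix X X ℝ}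
    (hAdef : A = diagonal D - Matrix.of fun x y => s x y * C x y)
    (hA : ∀ v : X → ℝ, v ≠ 0 → 0 < v ⬝ᵥ A *ᵥ v) {V : ℝ}
    (hV : ∫ z : X → 𝕂, Complex.exp (-∑ x, ∑ y, (A x y : ℂ) * (ζ (z x) * star (ζ (z y)))) = V) :
    ∫⁻ n : X × X → ℕ, (∏ e, ENNReal.ofReal (s e.1 e.2) ^ n e) *
        (∫⁻ z : X → 𝕂, ∏ x, ENNReal.ofReal (κ (outDeg n x) (inDeg n x) (‖z x‖ ^ 2) *
          Real.exp (-(D x * ‖z x‖ ^ 2))))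
      ∂Measure.pi (fun e : X × X => poissonMeasure (C e.1 e.2)) =
    ENNReal.ofReal (Real.exp (-∑ e : X × X, (C e.1 e.2 : ℝ)) * V) := by
  have hD : ∀ x, 0 < D x := by
    subst hAdef
    exact diag_pos_of_forall_dotProduct_pos (fun x y => mul_nonneg (hs x y) (C x y).2) hA
  set ρ := Measure.pi (fun e : X × X => poissonMeasure (C e.1 e.2)) with hρ
  let I : (X × X → ℕ) → X → ℝ := fun n x =>
    ∫ z : 𝕂, κ (outDeg n x) (inDeg n x) (‖z‖ ^ 2) * Real.exp (-(D x * ‖z‖ ^ 2))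
  have hI0 : ∀ n x, 0 ≤ I n x := fun n x =>
    integral_nonneg fun z => mul_nonneg (hκ0 _ _ _ (sq_nonneg _)) (Real.exp_pos _).le
  have h1 : ∀ n : X × X → ℕ, (∏ e, ENNReal.ofReal (s e.1 e.2) ^ n e) *
        ∫⁻ z : X → 𝕂, ∏ x, ENNReal.ofReal (κ (outDeg n x) (inDeg n x) (‖z x‖ ^ 2) *
          Real.exp (-(D x * ‖z x‖ ^ 2))) =
      ENNReal.ofReal ((∏ e, s e.1 e.2 ^ n e) * ∏ x, I n x) := by
    intro n
    have hnn : ∀ (x : X) (z : 𝕂), 0 ≤ κ (outDeg n x) (inDeg n x) (‖z‖ ^ 2) *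
        Real.exp (-(D x * ‖z‖ ^ 2)) := fun x z =>
      mul_nonneg (hκ0 _ _ _ (sq_nonneg _)) (Real.exp_pos _).le
    rw [ENNReal.ofReal_mul (Finset.prod_nonneg fun e _ => pow_nonneg (hs _ _) _),
      ENNReal.ofReal_prod_of_nonneg fun e _ => pow_nonneg (hs _ _) _]
    congr 1
    · exact Finset.prod_congr rfl fun e _ => (ENNReal.ofReal_pow (hs _ _) _).symm
    · simp_rw [← ENNReal.ofReal_prod_of_nonneg fun x (_ : x ∈ Finset.univ) => hnn x _]
      have hint : Integrable (fun z : X → 𝕂 => ∏ x, (κ (outDeg n x) (inDeg n x) (‖z x‖ ^ 2) *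
          Real.exp (-(D x * ‖z x‖ ^ 2)))) volume :=
        Integrable.fintype_prod (μ := fun _ => volume) (f := fun (x : X) (z : 𝕂) =>
          κ (outDeg n x) (inDeg n x) (‖z‖ ^ 2) * Real.exp (-(D x * ‖z‖ ^ 2)))
          fun x => hκi _ _ _ (hD x)
      rw [← ofReal_integral_eq_lintegral_ofReal hint
        (Filter.Eventually.of_forall fun z => Finset.prod_nonneg fun x _ => hnn x _)]
      congr 1
      exact integral_fintype_prod_volume_eq_prod (fun (x : X) (z : 𝕂) =>
        κ (outDeg n x) (inDeg n x) (‖z‖ ^ 2) * Real.exp (-(D x * ‖z‖ ^ 2)))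
  let g : (X → 𝕂) → ℂ := fun z => ∏ x, (Real.exp (-(D x * ‖z x‖ ^ 2)) : ℂ)
  let F : (X × X → ℕ) × (X → 𝕂) → ℂ := fun q =>
    (∏ e, ((s e.1 e.2 : ℂ) * (ζ (q.2 e.1) * star (ζ (q.2 e.2)))) ^ q.1 e) * g q.2
  have hFz : ∀ n, ∫ z, F (n, z) = (((∏ e, s e.1 e.2 ^ n e) * ∏ x, I n x : ℝ) : ℂ) := by
    intro n
    have e1 : ∀ z, F (n, z) = (∏ e : X × X, (s e.1 e.2 : ℂ) ^ n e) *
        ∏ x, (ζ (z x) ^ outDeg n x * star (ζ (z x)) ^ inDeg n x *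
          (Real.exp (-(D x * ‖z x‖ ^ 2)) : ℂ)) := by
      intro z
      simp only [F, g]
      simp_rw [mul_pow ((s _ _ : ℝ) : ℂ), Finset.prod_mul_distrib]
      rw [prod_pow_eq_prod_outDeg_inDeg n (fun x => ζ (z x)) (fun x => star (ζ (z x))),
        Finset.prod_mul_distrib, mul_assoc]
    simp_rw [e1]
    rw [integral_const_mul, integral_fintype_prod_volume_eq_prod (fun (x : X) (z : 𝕂) =>
      ζ z ^ outDeg n x * star (ζ z) ^ inDeg n x * (Real.exp (-(D x * ‖z‖ ^ 2)) : ℂ))]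
    rw [Complex.ofReal_mul, Complex.ofReal_prod, Complex.ofReal_prod]
    congr 1
    · simp only [Complex.ofReal_pow]
    · exact Finset.prod_congr rfl fun x _ => hκ _ _ _ (hD x)
  have hpi : ∀ w : X × X → ℂ, Integrable (fun n : X × X → ℕ => ∏ e, w e ^ n e) ρ ∧
      ∫ n : X × X → ℕ, ∏ e, w e ^ n e ∂ρ =
        Complex.exp (-∑ e : X × X, (C e.1 e.2 : ℂ)) * Complex.exp (∑ e : X × X, C e.1 e.2 * w e) := fun w =>
    integral_prod_pow_pi_poissonMeasure (fun e : X × X => C e.1 e.2) w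
  -- `‖F‖` is the same expression with each spin replaced by its modulus. Summing over `n` therefore
  -- gives a Gaussian at the real vector `(‖z x‖)`, integrable by coercivity of `A`; this justifies
  -- Fubini.
  have hnorm : ∀ q, ‖F q‖ = ((∏ e : X × X,
      ((s e.1 e.2 * (‖q.2 e.1‖ * ‖q.2 e.2‖) : ℝ) : ℂ) ^ q.1 e) * g q.2).re := by
    intro q
    have : ((∏ e : X × X, ((s e.1 e.2 * (‖q.2 e.1‖ * ‖q.2 e.2‖) : ℝ) : ℂ) ^ q.1 e) * g q.2) =
        (((∏ e : X × X, (s e.1 e.2 * (‖q.2 e.1‖ * ‖q.2 e.2‖)) ^ q.1 e) *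
          ∏ x, Real.exp (-(D x * ‖q.2 x‖ ^ 2)) : ℝ) : ℂ) := by
      simp only [g]; push_cast; rfl
    rw [this, Complex.ofReal_re]
    simp only [F, g, norm_mul, norm_prod, norm_pow, norm_star, hζn, Complex.norm_real]
    simp only [Real.norm_eq_abs, abs_of_nonneg (hs _ _), Real.abs_exp]
  obtain ⟨c, hc, hcoer⟩ := Matrix.exists_pos_forall_mul_sum_sq_le hA
  -- Stated for general `w`, `w'`, as it serves both for the moduli (integrability) and for the
  -- spins and their conjugates (the value).
  have hexp : ∀ (z : X → 𝕂) (w : X → ℂ) (w' : X → ℂ), (∀ x, w x * w' x = (‖z x‖ : ℂ) ^ 2) →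
      Complex.exp (∑ e : X × X, C e.1 e.2 * ((s e.1 e.2 : ℂ) * (w e.1 * w' e.2))) * g z =
        Complex.exp (-∑ x, ∑ y, (A x y : ℂ) * (w x * w' y)) := by
    intro z w w' hw
    simp only [g]
    push_cast
    rw [← Complex.exp_sum, ← Complex.exp_add, Fintype.sum_prod_type]
    congr 1
    rw [← Finset.sum_neg_distrib, ← Finset.sum_add_distrib]
    refine Finset.sum_congr rfl fun x _ => ?_
    have e2 : ∀ y, (A x y : ℂ) = (if x = y then (D x : ℂ) else 0) - s x y * C x y := by
      intro y
      rw [hAdef, Matrix.sub_apply, diagonal_apply, of_apply]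
      split_ifs <;> push_cast <;> ring
    simp_rw [e2, sub_mul, Finset.sum_sub_distrib, ite_mul, zero_mul, Finset.sum_ite_eq,
      Finset.mem_univ, if_true, hw]
    rw [neg_sub, sub_eq_add_neg]
    congr 1
    exact Finset.sum_congr rfl fun y _ => by ring
  have hFcont : AEStronglyMeasurable F (ρ.prod volume) := by
    refine Measurable.aestronglyMeasurable ?_
    refine Measurable.mul (Finset.measurable_prod _ fun e _ => ?_) ?_
    · have h : Continuous fun z : X → 𝕂 => (s e.1 e.2 : ℂ) * (ζ (z e.1) * star (ζ (z e.2))) := by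
        fun_prop
      exact (h.measurable.comp measurable_snd).pow ((measurable_pi_apply e).comp measurable_fst)
    · have h : Continuous g := by fun_prop
      exact h.measurable.comp measurable_snd
  have hFint : Integrable F (ρ.prod volume) := by
    rw [integrable_prod_iff' hFcont]
    refine ⟨Filter.Eventually.of_forall fun z =>
      (hpi fun e => (s e.1 e.2 : ℂ) * (ζ (z e.1) * star (ζ (z e.2)))).1.mul_const (g z), ?_⟩
    have e3 : ∀ z : X → 𝕂, ∫ n, ‖F (n, z)‖ ∂ρ = Real.exp (-∑ e : X × X, (C e.1 e.2 : ℝ)) *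
        Real.exp (-((fun x => ‖z x‖) ⬝ᵥ A *ᵥ fun x => ‖z x‖)) := by
      intro z
      simp_rw [hnorm]
      have hi := (hpi fun e => ((s e.1 e.2 * (‖z e.1‖ * ‖z e.2‖) : ℝ) : ℂ)).1.mul_const (g z)
      have := integral_re hi
      simp only [RCLike.re_to_complex] at this
      rw [this, integral_mul_const, (hpi _).2, mul_assoc]
      push_cast
      rw [hexp z (fun x => (‖z x‖ : ℂ)) (fun x => (‖z x‖ : ℂ)) fun x => (sq _).symm]
      rw [← Complex.ofReal_re (Real.exp _ * Real.exp _)]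
      congr 1
      push_cast
      congr 2
      simp only [dotProduct, mulVec, Finset.mul_sum]
      push_cast
      refine congrArg _ (Finset.sum_congr rfl fun x _ => Finset.sum_congr rfl fun y _ => by ring)
    simp_rw [e3]
    refine Integrable.const_mul ?_ _
    refine (integrable_exp_neg_mul_sum_norm_sq (X := X) (𝕂 := 𝕂) hc).mono' ?_
      (Filter.Eventually.of_forall fun z => ?_)
    · have : Continuous fun z : X → 𝕂 =>
          Real.exp (-((fun x => ‖z x‖) ⬝ᵥ A *ᵥ fun x => ‖z x‖)) := by fun_prop
      exact this.aestronglyMeasurable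
    · rw [Real.norm_of_nonneg (Real.exp_pos _).le]
      exact Real.exp_le_exp.2 (neg_le_neg (hcoer _))
  have hswap := integral_integral_swap hFint (f := fun n z => F (n, z))
  have hGint : Integrable (fun n => (∏ e, s e.1 e.2 ^ n e) * ∏ x, I n x) ρ := by
    have := hFint.integral_prod_left.re
    simp_rw [hFz] at this
    exact this
  simp_rw [h1]
  rw [← ofReal_integral_eq_lintegral_ofReal hGint (Filter.Eventually.of_forall fun n =>
    mul_nonneg (Finset.prod_nonneg fun e _ => pow_nonneg (hs _ _) _)
      (Finset.prod_nonneg fun x _ => hI0 n x))]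
  congr 1
  simp_rw [hFz, integral_complex_ofReal] at hswap
  rw [← Complex.ofReal_inj, hswap]
  push_cast
  rw [← hV, ← integral_const_mul]
  refine integral_congr_ae (Filter.Eventually.of_forall fun z => ?_)
  simp only [F]
  rw [integral_mul_const, (hpi _).2, mul_assoc,
    hexp z (fun x => ζ (z x)) (fun x => star (ζ (z x))) fun x => by
      rw [← hζn]; exact Complex.mul_conj' _]

/-- The moments of the real Gaussian density. -/
theorem integral_real_moment (a b : ℕ) (c : ℝ) :
    ∫ z : ℝ, (z : ℂ) ^ a * star (z : ℂ) ^ b * (Real.exp (-(c * ‖z‖ ^ 2)) : ℂ) =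
      ((∫ z : ℝ, (if Even (a + b) then (‖z‖ ^ 2) ^ ((a + b) / 2) else 0) *
        Real.exp (-(c * ‖z‖ ^ 2)) : ℝ) : ℂ) := by
  have h1 : ∀ z : ℝ, (z : ℂ) ^ a * star (z : ℂ) ^ b * (Real.exp (-(c * ‖z‖ ^ 2)) : ℂ) =
      ((z ^ (a + b) * Real.exp (-(c * ‖z‖ ^ 2)) : ℝ) : ℂ) := by
    intro z
    rw [show star (z : ℂ) = z from Complex.conj_ofReal z, pow_add]
    push_cast; rfl
  simp_rw [h1, integral_complex_ofReal]
  congr 1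
  split_ifs with h
  · refine integral_congr_ae (Filter.Eventually.of_forall fun z => ?_)
    obtain ⟨k, hk⟩ := h
    simp only [hk, ← two_mul, Nat.mul_div_cancel_left k two_pos, pow_mul, Real.norm_eq_abs, sq_abs]
  · simp only [zero_mul, integral_zero]
    -- For an odd exponent the reflection `z ↦ -z` changes the sign of the integrand.
    have h2 := integral_neg_eq_self (fun z : ℝ => z ^ (a + b) * Real.exp (-(c * ‖z‖ ^ 2))) volume
    simp only [(Nat.not_even_iff_odd.1 h).neg_pow, norm_neg, neg_mul] at h2
    rw [integral_neg] at h2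
    linarith

/-- The moments of the complex Gaussian density. -/
theorem integral_complex_moment (a b : ℕ) (c : ℝ) :
    ∫ z : ℂ, z ^ a * star z ^ b * (Real.exp (-(c * ‖z‖ ^ 2)) : ℂ) =
      ((∫ z : ℂ, (if a = b then (‖z‖ ^ 2) ^ a else 0) * Real.exp (-(c * ‖z‖ ^ 2)) : ℝ) : ℂ) := by
  split_ifs with h
  · subst h
    rw [← integral_complex_ofReal]
    refine integral_congr_ae (Filter.Eventually.of_forall fun z => ?_)
    have h1 : z * star z = (‖z‖ : ℂ) ^ 2 := Complex.mul_conj' z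
    simp only [← mul_pow, h1]
    push_cast; rfl
  · simp only [zero_mul, integral_zero, Complex.ofReal_zero]
    -- Rotation by `θ` multiplies `z^a z̄^b` by `e^{i(a-b)θ} = -1`, so the integral equals its own
    -- negative.
    obtain ⟨θ, hθ⟩ : ∃ θ : ℝ, ((a : ℝ) - b) * θ = Real.pi :=
      ⟨Real.pi / ((a : ℝ) - b), mul_div_cancel₀ _ (sub_ne_zero.2 (by exact_mod_cast h))⟩
    have h1 := (rotation (Circle.exp θ)).measurePreserving.integral_comp
      (rotation (Circle.exp θ)).toHomeomorph.measurableEmbedding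
      (fun z : ℂ => z ^ a * star z ^ b * (Real.exp (-(c * ‖z‖ ^ 2)) : ℂ))
    have h2 : ∀ z : ℂ, (rotation (Circle.exp θ) z) ^ a * star (rotation (Circle.exp θ) z) ^ b *
        (Real.exp (-(c * ‖rotation (Circle.exp θ) z‖ ^ 2)) : ℂ) =
        -(z ^ a * star z ^ b * (Real.exp (-(c * ‖z‖ ^ 2)) : ℂ)) := by
      intro z
      have h3 : ((Circle.exp θ : Circle) : ℂ) ^ a * star ((Circle.exp θ : Circle) : ℂ) ^ b = -1 := by
        have e1 : star ((Circle.exp θ : Circle) : ℂ) = Complex.exp (-(θ * Complex.I)) := by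
          rw [Circle.coe_exp, Complex.star_def, ← Complex.exp_conj]
          simp
        rw [e1, Circle.coe_exp, ← Complex.exp_nat_mul, ← Complex.exp_nat_mul, ← Complex.exp_add,
          ← Complex.exp_pi_mul_I, ← hθ]
        congr 1
        push_cast; ring
      rw [LinearIsometryEquiv.norm_map, rotation_apply, star_mul, mul_pow, mul_pow]
      linear_combination (z ^ a * star z ^ b * (Real.exp (-(c * ‖z‖ ^ 2)) : ℂ)) * h3
    simp_rw [h2, integral_neg] at h1
    linear_combination (-1 / 2 : ℂ) * h1

end SpinExpansion

/-! ### Jump numbers and occupation times of the loop of a based loop. -/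

section LoopFunctionals

theorem List.countP_ofFn_eq_sum {α : Type*} {n : ℕ} (p : α → Bool) (f : Fin n → α) :
    (List.ofFn f).countP p = ∑ i, if p (f i) then 1 else 0 := by
  induction n with
  | zero => simp
  | succ n ih => rw [List.ofFn_succ, List.countP_cons, ih, Fin.sum_univ_succ, add_comm]

theorem List.zip_rotate_one_ofFn {α : Type*} {n : ℕ} (f : Fin (n + 1) → α) :
    (List.ofFn f).zip ((List.ofFn f).rotate 1) = List.ofFn fun i => (f i, f (i + 1)) := by
  refine List.ext_getElem (by simp) fun i h1 h2 => ?_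
  simp only [List.getElem_zip, List.getElem_ofFn, List.getElem_rotate, List.length_ofFn]
  congr 2
  ext
  simp [Fin.val_add]

variable {X : Type*}

open Classical in
theorem BasedLoop.jumps_toLoop {p : ℕ} {x : Fin (p + 1) → X} (u : Fin (p + 1) → ℝ)
    (hx : x (Fin.last p) = x 0) (a b : X) :
    Loop.jumps a b (BasedLoop.toLoop (BasedLoop.mk x u)) =
      ∑ i : Fin p, if a ≠ b ∧ x i.castSucc = a ∧ x i.succ = b then 1 else 0 := by
  cases p with
  | zero =>
    change List.countP _ (List.zip [(x 0, u 0)] (List.rotate [(x 0, u 0)] 1)) = _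
    simp only [List.rotate_singleton, List.zip_cons_cons, List.zip_nil_right, Finset.univ_eq_empty,
      Finset.sum_empty, List.countP_eq_zero]
    simp
    rintro hab rfl
    exact hab
  | succ p =>
    change List.countP _ (List.zip (List.ofFn _) (List.rotate (List.ofFn _) 1)) = _
    rw [List.zip_rotate_one_ofFn, List.countP_ofFn_eq_sum]
    refine Finset.sum_congr rfl fun i _ => ?_
    -- The sum `i + 1` is cyclic in `Fin (p + 1)`: at the last index it returns to `0`, where `hx`
    -- identifies `x 0` with the endpoint of the based loop.
    have h : x (Fin.castSucc (i + 1)) = x i.succ := by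
      rcases Fin.eq_castSucc_or_eq_last i with ⟨j, rfl⟩ | rfl
      · congr 1
        rw [Fin.coeSucc_eq_succ]
        rfl
      · rw [Fin.last_add_one, Fin.castSucc_zero, Fin.succ_last, hx]
    simp only [h, decide_eq_true_eq]

open Classical in
theorem Loop.time_ofFn {n : ℕ} (v : Fin n → X × ℝ) (a : X) :
    Loop.time a ((List.ofFn v : List (X × ℝ)) : Cycle (X × ℝ)) =
      ∑ i, if (v i).1 = a then ENNReal.ofReal (v i).2 else 0 := by
  have h : (Multiset.ofList (List.ofFn v)) = Finset.univ.val.map v := by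
    rw [List.ofFn_eq_map]; rfl
  change (((Multiset.ofList (List.ofFn v)).filter fun q : X × ℝ => q.1 = a).map
    fun q => ENNReal.ofReal q.2).sum = _
  rw [h, Multiset.filter_map, Multiset.map_map, ← Finset.sum_filter]
  rfl

theorem BasedLoop.toLoop_zero (x : Fin 1 → X) (u : Fin 1 → ℝ) :
    BasedLoop.toLoop (BasedLoop.mk x u) =
      ((List.ofFn fun i => (x i, u i) : List (X × ℝ)) : Cycle (X × ℝ)) := by
  rw [List.ofFn_succ, List.ofFn_zero]
  rfl

open Classical in
-- The merged stay at the base point has length `u_0 + u_p`; positivity of the times allows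
-- `ENNReal.ofReal` to be split over this sum.
theorem BasedLoop.time_toLoop {p : ℕ} {x : Fin (p + 1) → X} {u : Fin (p + 1) → ℝ}
    (hx : x (Fin.last p) = x 0) (hu : ∀ i, 0 < u i) (a : X) :
    Loop.time a (BasedLoop.toLoop (BasedLoop.mk x u)) =
      ∑ i, if x i = a then ENNReal.ofReal (u i) else 0 := by
  cases p with
  | zero => rw [BasedLoop.toLoop_zero, Loop.time_ofFn]
  | succ p =>
    refine (Loop.time_ofFn _ a).trans ?_
    rw [Fin.sum_univ_castSucc (n := p + 1), Fin.sum_univ_succ (n := p),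
      Fin.sum_univ_succ (n := p), hx]
    simp only [if_true, Fin.succ_ne_zero, if_false, add_zero, Fin.castSucc_zero]
    rw [ENNReal.ofReal_add (hu _).le (hu _).le]
    by_cases h : x 0 = a
    · simp only [h, if_true]; ring
    · simp only [h, if_false]; ring

variable [Fintype X]

/-- There are countably many vertex sequences, all with the discrete σ-algebra, so only the
dependence on the times matters. -/
theorem BasedLoop.measurable_iff {β : Type*} [MeasurableSpace β] {f : BasedLoop X → β} :
    Measurable f ↔ ∀ (p : ℕ) (x : Fin (p + 1) → X), Measurable fun u => f (BasedLoop.mk x u) := by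
  let : MeasurableSpace X := ⊤
  have : DiscreteMeasurableSpace X := ⟨fun _ => trivial⟩
  constructor
  · intro hf p x s hs
    have h1 : MeasurableSet (Sigma.mk (β := fun p : ℕ => (Fin (p + 1) → X) × (Fin (p + 1) → ℝ)) p ⁻¹'
        (f ⁻¹' s)) := MeasurableSpace.measurableSet_iInf.1 (hf hs) p
    exact measurable_prodMk_left h1
  · intro h s hs
    refine MeasurableSpace.measurableSet_iInf.2 fun p => ?_
    have : Measurable fun q : (Fin (p + 1) → X) × (Fin (p + 1) → ℝ) => f ⟨p, q.1, q.2⟩ :=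
      measurable_from_prod_countable_right fun x => h p x
    exact this hs

theorem Loop.measurable_of_forall {β : Type*} [MeasurableSpace β] {f : Loop X → β}
    (h : ∀ (p : ℕ) (x : Fin (p + 1) → X), Measurable fun u => f (BasedLoop.toLoop (BasedLoop.mk x u))) :
    Measurable f := fun _ hs =>
  (BasedLoop.measurable_iff (f := f ∘ BasedLoop.toLoop)).2 h hs

omit [Fintype X] in
theorem BasedLoop.measurable_toLoop : Measurable (BasedLoop.toLoop (X := X)) := fun _ hs => hs

theorem BasedLoop.measurable_mk {p : ℕ} (x : Fin (p + 1) → X) :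
    Measurable (BasedLoop.mk x) := by
  exact (BasedLoop.measurable_iff (f := id)).1 measurable_id p x

theorem Loop.measurable_jumps (a b : X) : Measurable (Loop.jumps a b) := by
  classical
  refine Loop.measurable_of_forall fun p x => ?_
  cases p with
  | zero =>
    simp_rw [BasedLoop.jumps_toLoop _ (rfl : x (Fin.last 0) = x 0)]
    exact measurable_const
  | succ p =>
    -- Measurability must cover the vertex sequences that do not close up as well, hence the count
    -- with the cyclic successor instead of `BasedLoop.jumps_toLoop`. It does not depend on the
    -- times.
    have : ∀ u, Loop.jumps a b (BasedLoop.toLoop (BasedLoop.mk x u)) =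
        ∑ i : Fin (p + 1), if a ≠ b ∧ x i.castSucc = a ∧ x (i + 1).castSucc = b then 1 else 0 := by
      intro u
      change List.countP _ (List.zip (List.ofFn _) (List.rotate (List.ofFn _) 1)) = _
      rw [List.zip_rotate_one_ofFn, List.countP_ofFn_eq_sum]
      simp only [decide_eq_true_eq]
    simp_rw [this]
    exact measurable_const

theorem Loop.measurable_time (a : X) : Measurable (Loop.time a) := by
  classical
  refine Loop.measurable_of_forall fun p x => ?_
  cases p with
  | zero =>
    simp_rw [BasedLoop.toLoop_zero, Loop.time_ofFn]
    refine Finset.measurable_sum _ fun i _ => ?_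
    split_ifs
    · exact (measurable_pi_apply i).ennreal_ofReal
    · exact measurable_const
  | succ p =>
    have h : Measurable fun u : Fin (p + 2) → ℝ => ∑ i : Fin (p + 1), if x i.castSucc = a then
        ENNReal.ofReal (u i.castSucc + if i = 0 then u (Fin.last (p + 1)) else 0) else 0 := by
      refine Finset.measurable_sum _ fun i _ => ?_
      split_ifs
      all_goals fun_prop
    convert! h using 2 with u
    exact Loop.time_ofFn _ a

end LoopFunctionals

/-! ### Integrals against the loop measure as traces of resolvents. -/

section LoopMeasure

theorem lintegral_pos_prod_exp {p : ℕ} {β : Fin p → ℝ} (hβ : ∀ i, 0 < β i) :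
    ∫⁻ u in {u : Fin p → ℝ | ∀ i, 0 < u i}, ∏ i, ENNReal.ofReal (Real.exp (-(β i * u i))) =
      ∏ i, ENNReal.ofReal (β i)⁻¹ := by
  have hset : {u : Fin p → ℝ | ∀ i, 0 < u i} = Set.univ.pi fun _ => Set.Ioi 0 := by
    ext u; simp
  have hint : ∀ i, Integrable (fun t : ℝ => Real.exp (-(β i * t))) (volume.restrict (Set.Ioi 0)) := by
    intro i
    have := integrableOn_exp_mul_Ioi (neg_neg_of_pos (hβ i)) 0
    simpa [IntegrableOn, neg_mul] using this
  rw [hset, volume_pi, Measure.restrict_pi_pi]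
  simp_rw [← ENNReal.ofReal_prod_of_nonneg fun i (_ : i ∈ Finset.univ) => (Real.exp_pos _).le]
  rw [← ofReal_integral_eq_lintegral_ofReal
    (Integrable.fintype_prod (f := fun (i : Fin p) (t : ℝ) => Real.exp (-(β i * t))) hint)
    (Filter.Eventually.of_forall fun u => Finset.prod_nonneg fun i _ => (Real.exp_pos _).le),
    integral_fintype_prod_eq_prod (fun (i : Fin p) (t : ℝ) => Real.exp (-(β i * t))),
    ENNReal.ofReal_prod_of_nonneg fun i _ => integral_nonneg fun t => (Real.exp_pos _).le]
  refine Finset.prod_congr rfl fun i _ => ?_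
  congr 1
  have := integral_exp_mul_Ioi (neg_neg_of_pos (hβ i)) 0
  simpa [neg_mul] using this

/-- Removes the factor `1/t` of the loop measure at the price of an additional killing rate `r`. -/
theorem lintegral_exp_neg_mul_Ioi {t : ℝ} (ht : 0 < t) :
    ∫⁻ r in Set.Ioi (0 : ℝ), ENNReal.ofReal (Real.exp (-((1 + r) * t))) =
      ENNReal.ofReal (Real.exp (-t) / t) := by
  have h1 : ∀ r : ℝ, Real.exp (-((1 + r) * t)) = Real.exp (-t) * Real.exp (-t * r) := fun r => by
    rw [← Real.exp_add]; congr 1; ring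
  simp_rw [h1]
  rw [← ofReal_integral_eq_lintegral_ofReal
    ((integrableOn_exp_mul_Ioi (neg_neg_of_pos ht) 0).const_mul _)
    (Filter.Eventually.of_forall fun u => by positivity), integral_const_mul,
    integral_exp_mul_Ioi (neg_neg_of_pos ht) 0]
  simp [div_eq_mul_inv]

theorem measurableSet_pos {p : ℕ} : MeasurableSet {u : Fin p → ℝ | ∀ i, 0 < u i} := by
  have : {u : Fin p → ℝ | ∀ i, 0 < u i} = ⋂ i, {u | 0 < u i} := by ext; simp
  rw [this]
  exact MeasurableSet.iInter fun i => measurableSet_lt measurable_const (measurable_pi_apply i)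

/-- For fixed `r` the weight `e^{-(1+r)Σu}` is a product over the stays, which `e^{-t}/t` is not. -/
theorem lintegral_timeMeasure {p : ℕ} {h : (Fin (p + 1) → ℝ) → ℝ≥0∞} (hh : Measurable h) :
    ∫⁻ u, h u ∂ElectricalNetwork.timeMeasure p =
      ∫⁻ r in Set.Ioi (0 : ℝ), ∫⁻ u in {u : Fin (p + 1) → ℝ | ∀ i, 0 < u i},
        ENNReal.ofReal (Real.exp (-((1 + r) * ∑ i, u i))) * h u := by
  rw [ElectricalNetwork.timeMeasure, lintegral_withDensity_eq_lintegral_mul _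
    (by fun_prop) hh]
  rw [lintegral_lintegral_swap (by fun_prop)]
  refine setLIntegral_congr_fun measurableSet_pos fun u hu => ?_
  simp only [Pi.mul_apply]
  rw [lintegral_mul_const _ (by fun_prop), lintegral_exp_neg_mul_Ioi]
  exact Finset.sum_pos (fun i _ => hu i) Finset.univ_nonempty

open Matrix

variable {X : Type*} [Fintype X] [DecidableEq X]

theorem Matrix.pow_apply_eq_sum_paths {R : Type*} [CommSemiring R] (T : Matrix X X R) (p : ℕ)
    (a b : X) : (T ^ p) a b = ∑ x : Fin (p + 1) → X,
      if x 0 = a ∧ x (Fin.last p) = b then ∏ i : Fin p, T (x i.castSucc) (x i.succ) else 0 := by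
  induction p generalizing a with
  | zero =>
    rw [pow_zero, one_apply, ← (Equiv.funUnique (Fin 1) X).symm.sum_comp]
    simp [Equiv.funUnique, ite_and]
  | succ p ih =>
    have hR : (∑ x : Fin (p + 1 + 1) → X, if x 0 = a ∧ x (Fin.last (p + 1)) = b then
        ∏ i : Fin (p + 1), T (x i.castSucc) (x i.succ) else 0) = ∑ x : Fin (p + 1) → X,
        if x (Fin.last p) = b then T a (x 0) * ∏ i : Fin p, T (x i.castSucc) (x i.succ) else 0 := by
      rw [← (Fin.consEquiv fun _ => X).sum_comp, Fintype.sum_prod_type]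
      simp only [Fin.consEquiv_apply, Fin.cons_zero, Fin.prod_univ_succ, Fin.castSucc_zero,
        Fin.cons_succ, ← Fin.succ_last, Fin.castSucc_succ]
      rw [Finset.sum_eq_single a (fun c _ hc => by simp [hc]) (by simp)]
      simp only [true_and]
    rw [hR, pow_succ', mul_apply]
    have hL : ∀ z, T a z * (T ^ p) z b = ∑ x : Fin (p + 1) → X, T a z *
        if x 0 = z ∧ x (Fin.last p) = b then ∏ i : Fin p, T (x i.castSucc) (x i.succ) else 0 :=
      fun z => by rw [ih, Finset.mul_sum]
    rw [Finset.sum_congr rfl fun z _ => hL z, Finset.sum_comm]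
    refine Finset.sum_congr rfl fun x _ => ?_
    rw [Finset.sum_eq_single (x 0) (fun c _ hc => by simp [hc.symm]) (by simp)]
    simp

theorem Matrix.trace_pow_mul_diagonal {R : Type*} [CommSemiring R] (T : Matrix X X R) (d : X → R)
    (p : ℕ) : (T ^ p * diagonal d).trace = ∑ x : Fin (p + 1) → X,
      if x (Fin.last p) = x 0 then (∏ i : Fin p, T (x i.castSucc) (x i.succ)) * d (x (Fin.last p))
      else 0 := by
  simp only [trace, diag_apply, mul_diagonal, Matrix.pow_apply_eq_sum_paths, Finset.sum_mul]
  rw [Finset.sum_comm]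
  refine Finset.sum_congr rfl fun x _ => ?_
  rw [Finset.sum_eq_single (x 0) (fun c _ hc => by simp [hc.symm]) (by simp)]
  by_cases h : x (Fin.last p) = x 0 <;> simp [h]

namespace ElectricalNetwork

variable (𝒢 : ElectricalNetwork X)

omit [DecidableEq X] in
theorem lintegral_loopMeasure {g : Loop X → ℝ≥0∞} (hg : Measurable g) :
    ∫⁻ l, g l ∂𝒢.loopMeasure = ∑' p : ℕ, ∑ x : Fin (p + 1) → X, 𝒢.loopWeight x *
      ∫⁻ u, g (BasedLoop.toLoop (BasedLoop.mk x u)) ∂timeMeasure p := by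
  rw [loopMeasure, lintegral_map hg BasedLoop.measurable_toLoop, basedLoopMeasure,
    lintegral_sum_measure]
  refine tsum_congr fun p => ?_
  rw [lintegral_finsetSum_measure]
  refine Finset.sum_congr rfl fun x _ => ?_
  rw [lintegral_smul_measure, lintegral_map (f := fun l => g l.toLoop)
    (hg.comp (f := BasedLoop.toLoop) BasedLoop.measurable_toLoop) (BasedLoop.measurable_mk x), smul_eq_mul]

/-- The matrix `λ + b - s C`. -/
noncomputable def loopMatrix (s : X → X → ℝ) (b : X → ℝ) : Matrix X X ℝ :=
  diagonal (fun x => 𝒢.dual x + b x) - Matrix.of fun x y => s x y * 𝒢.cond x y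

variable {𝒢}

omit [DecidableEq X] in
theorem energy_eq (v : X → ℝ) :
    𝒢.energy v = ∑ x, 𝒢.dual x * v x ^ 2 - ∑ x, ∑ y, 𝒢.cond x y * (v x * v y) := by
  have h1 : ∑ x, ∑ y, 𝒢.cond x y * v y ^ 2 = ∑ x, ∑ y, 𝒢.cond x y * v x ^ 2 := by
    rw [Finset.sum_comm]
    exact Finset.sum_congr rfl fun x _ => Finset.sum_congr rfl fun y _ => by rw [𝒢.cond_symm]
  have h2 : ∑ x, ∑ y, 𝒢.cond x y * (v x - v y) ^ 2 =
      ∑ x, ∑ y, 𝒢.cond x y * v x ^ 2 + ∑ x, ∑ y, 𝒢.cond x y * v y ^ 2 -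
        2 * ∑ x, ∑ y, 𝒢.cond x y * (v x * v y) := by
    rw [Finset.mul_sum, ← Finset.sum_add_distrib, ← Finset.sum_sub_distrib]
    refine Finset.sum_congr rfl fun x _ => ?_
    rw [Finset.mul_sum, ← Finset.sum_add_distrib, ← Finset.sum_sub_distrib]
    exact Finset.sum_congr rfl fun y _ => by ring
  rw [energy, h2, h1]
  simp only [dual, add_mul, Finset.sum_mul, Finset.sum_add_distrib]
  ring

omit [DecidableEq X] in
theorem dual_pos (h𝒢 : 𝒢.Transient) (x : X) : 0 < 𝒢.dual x := by
  classical
  have h := h𝒢 (Pi.single x 1) (by simp)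
  rw [energy_eq] at h
  have h1 : ∑ y, 𝒢.dual y * (Pi.single x 1 : X → ℝ) y ^ 2 = 𝒢.dual x := by
    simp [Pi.single_apply, ite_pow]
  have h2 : 0 ≤ ∑ z, ∑ y, 𝒢.cond z y * ((Pi.single x 1 : X → ℝ) z * (Pi.single x 1 : X → ℝ) y) :=
    Finset.sum_nonneg fun z _ => Finset.sum_nonneg fun y _ => by
      refine mul_nonneg (𝒢.cond_nonneg _ _) (mul_nonneg ?_ ?_) <;>
        (rw [Pi.single_apply]; split_ifs <;> norm_num)
  rw [h1] at h
  linarith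

/-- Replacing `v` by `|v|` and `s` by `1` can only increase the off-diagonal terms, and dropping `b`
can only decrease the diagonal ones. The form is thus at least the energy of `|v|`. -/
theorem loopMatrix_posDef (h𝒢 : 𝒢.Transient) {s : X → X → ℝ} (hs0 : ∀ x y, 0 ≤ s x y)
    (hs1 : ∀ x y, s x y ≤ 1) {b : X → ℝ} (hb : ∀ x, 0 ≤ b x) (v : X → ℝ) (hv : v ≠ 0) :
    0 < v ⬝ᵥ 𝒢.loopMatrix s b *ᵥ v := by
  have h1 : v ⬝ᵥ 𝒢.loopMatrix s b *ᵥ v = ∑ x, (𝒢.dual x + b x) * v x ^ 2 -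
      ∑ x, ∑ y, s x y * 𝒢.cond x y * (v x * v y) := by
    rw [loopMatrix, sub_mulVec, dotProduct_sub]
    congr 1
    · exact Finset.sum_congr rfl fun x _ => by rw [mulVec_diagonal]; ring
    · simp only [dotProduct, mulVec, of_apply, Finset.mul_sum]
      exact Finset.sum_congr rfl fun x _ => Finset.sum_congr rfl fun y _ => by ring
  have h2 := h𝒢 (fun x => |v x|) fun h => hv (funext fun x => by simpa using congrFun h x)
  rw [energy_eq] at h2
  simp only [sq_abs] at h2
  rw [h1]
  refine h2.trans_le (sub_le_sub (Finset.sum_le_sum fun x _ => ?_)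
    (Finset.sum_le_sum fun x _ => Finset.sum_le_sum fun y _ => ?_))
  · exact mul_le_mul_of_nonneg_right (by linarith [hb x]) (sq_nonneg _)
  · have hc := 𝒢.cond_nonneg x y
    rw [← abs_mul]
    calc s x y * 𝒢.cond x y * (v x * v y) ≤ s x y * 𝒢.cond x y * |v x * v y| :=
          mul_le_mul_of_nonneg_left (le_abs_self _) (mul_nonneg (hs0 x y) hc)
      _ ≤ 𝒢.cond x y * |v x * v y| := by
          refine mul_le_mul_of_nonneg_right ?_ (abs_nonneg _)
          exact mul_le_of_le_one_left hc (hs1 x y)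

/-- The sum over the loops of the weights with modified transitions and holding times. -/
theorem tsum_loopWeight_resolvent (h𝒢 : 𝒢.Transient) {s : X → X → ℝ} (hs0 : ∀ x y, 0 ≤ s x y)
    (hs1 : ∀ x y, s x y ≤ 1) {b : X → ℝ} (hb : ∀ x, 0 ≤ b x) {r : ℝ} (hr : 0 ≤ r) :
    ∑' p : ℕ, ∑ x : Fin (p + 1) → X, 𝒢.loopWeight x *
      ((∏ i : Fin p, ENNReal.ofReal (s (x i.castSucc) (x i.succ))) *
        ∫⁻ u in {u : Fin (p + 1) → ℝ | ∀ i, 0 < u i},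
          ∏ i, ENNReal.ofReal (Real.exp (-((1 + r + b (x i) / 𝒢.dual (x i)) * u i)))) =
      ENNReal.ofReal ((𝒢.loopMatrix s b + r • diagonal 𝒢.dual)⁻¹ * diagonal 𝒢.dual).trace ∧
    0 ≤ ((𝒢.loopMatrix s b + r • diagonal 𝒢.dual)⁻¹ * diagonal 𝒢.dual).trace := by
  have hl := dual_pos h𝒢
  set D : X → ℝ := fun x => 𝒢.dual x + b x + r * 𝒢.dual x with hDdef
  have hD : ∀ x, 0 < D x := fun x => by
    have := hl x; have := hb x; have := mul_nonneg hr (hl x).le; simp only [hDdef]; linarith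
  set S : Matrix X X ℝ := Matrix.of fun x y => s x y * 𝒢.cond x y with hS
  have hS0 : ∀ x y, 0 ≤ S x y := fun x y => mul_nonneg (hs0 x y) (𝒢.cond_nonneg x y)
  have hA : 𝒢.loopMatrix s b + r • diagonal 𝒢.dual = diagonal D - S := by
    rw [loopMatrix, hDdef, ← diagonal_smul, sub_add_eq_add_sub, diagonal_add]
    rfl
  have hpd : ∀ v : X → ℝ, v ≠ 0 → 0 < v ⬝ᵥ (diagonal D - S) *ᵥ v := fun v hv => by
    rw [← hA]
    exact dotProduct_add_smul_diagonal_pos (loopMatrix_posDef h𝒢 hs0 hs1 hb) hl hr v hv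
  set T : Matrix X X ℝ := diagonal (fun x => (D x)⁻¹) * S with hT
  have hT0 : ∀ x y, 0 ≤ T x y := fun x y => by
    rw [hT, diagonal_mul]; exact mul_nonneg (inv_nonneg.2 (hD x).le) (hS0 x y)
  have hsum : HasSum (fun p : ℕ => (T ^ p * diagonal fun x => (D x)⁻¹ * 𝒢.dual x).trace)
      ((𝒢.loopMatrix s b + r • diagonal 𝒢.dual)⁻¹ * diagonal 𝒢.dual).trace := by
    have h := (hasSum_neumann hS0 hpd).mul_right (diagonal 𝒢.dual)
    rw [hA]
    have h2 := h.map (traceAddMonoidHom X ℝ) (by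
      change Continuous fun M : Matrix X X ℝ => M.trace
      fun_prop)
    simp only [Function.comp_def, traceAddMonoidHom_apply, mul_assoc, diagonal_mul_diagonal] at h2
    exact h2
  have hnn : ∀ p, 0 ≤ (T ^ p * diagonal fun x => (D x)⁻¹ * 𝒢.dual x).trace := fun p => by
    rw [Matrix.trace_pow_mul_diagonal]
    refine Finset.sum_nonneg fun x _ => ?_
    split_ifs
    · exact mul_nonneg (Finset.prod_nonneg fun i _ => hT0 _ _)
        (mul_nonneg (inv_nonneg.2 (hD _).le) (hl _).le)
    · exact le_rfl
  refine ⟨?_, hsum.nonneg hnn⟩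
  rw [← hsum.tsum_eq, ENNReal.ofReal_tsum_of_nonneg hnn hsum.summable]
  refine tsum_congr fun p => ?_
  rw [Matrix.trace_pow_mul_diagonal, ENNReal.ofReal_sum_of_nonneg fun x _ => by
    split_ifs
    · exact mul_nonneg (Finset.prod_nonneg fun i _ => hT0 _ _)
        (mul_nonneg (inv_nonneg.2 (hD _).le) (hl _).le)
    · exact le_rfl]
  refine Finset.sum_congr rfl fun x _ => ?_
  have hβ : ∀ y, (1 + r + b y / 𝒢.dual y)⁻¹ = (D y)⁻¹ * 𝒢.dual y := fun y => by
    have h1 := (hl y).ne'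
    have h2 := (hD y).ne'
    have h3 : D y = 𝒢.dual y * (1 + r + b y / 𝒢.dual y) := by
      simp only [hDdef]; field_simp; ring
    rw [h3, mul_inv]
    field_simp
  have hβpos : ∀ y, 0 < 1 + r + b y / 𝒢.dual y := fun y => by
    have := div_nonneg (hb y) (hl y).le; linarith
  rw [lintegral_pos_prod_exp fun i => hβpos (x i), loopWeight]
  split_ifs with hx
  -- There is one more stay than jumps. Each of the first `p` stays contributes `λ/D`, which turns
  -- `s C/λ` into an entry of `T`; the last one supplies the diagonal factor under the trace.
  · rw [Fin.prod_univ_castSucc, ENNReal.ofReal_mul (Finset.prod_nonneg fun i _ => hT0 _ _),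
      ENNReal.ofReal_prod_of_nonneg fun i _ => hT0 _ _, ← mul_assoc, ← mul_assoc,
      ← Finset.prod_mul_distrib, ← Finset.prod_mul_distrib, hβ]
    congr 1
    refine Finset.prod_congr rfl fun i _ => ?_
    have ht : 0 ≤ 𝒢.transition (x i.castSucc) (x i.succ) :=
      div_nonneg (𝒢.cond_nonneg _ _) (hl _).le
    rw [← ENNReal.ofReal_mul ht, ← ENNReal.ofReal_mul (mul_nonneg ht (hs0 _ _)), hβ]
    congr 1
    have h1 := (hl (x i.castSucc)).ne'
    rw [hT, diagonal_mul, hS, of_apply, transition]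
    field_simp
  · simp

end ElectricalNetwork

end LoopMeasure

/-! ### Laplace exponent of the loop measure. -/

namespace ElectricalNetwork

open Matrix

variable {X : Type*} [Fintype X] (𝒢 : ElectricalNetwork X)

/-- A linear combination of the numbers of jumps and of the occupation times of a loop. -/
noncomputable def loopFunctional (a : X → X → ℕ) (b : X → ℕ) (l : Loop X) : ℝ≥0∞ :=
  ∑ x, ∑ y, (a x y : ℝ≥0∞) * (Loop.jumps x y l : ℝ≥0∞) +
    ∑ x, (b x : ℝ≥0∞) * (Loop.time x l / ENNReal.ofReal (𝒢.dual x))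

theorem measurable_loopFunctional (a : X → X → ℕ) (b : X → ℕ) :
    Measurable (𝒢.loopFunctional a b) := by
  refine Measurable.add ?_ ?_
  · refine Finset.measurable_sum _ fun x _ => Finset.measurable_sum _ fun y _ => ?_
    exact ((measurable_of_countable fun n : ℕ => (n : ℝ≥0∞)).comp
      (Loop.measurable_jumps x y)).const_mul _
  · refine Finset.measurable_sum _ fun x _ => ?_
    exact ((Loop.measurable_time x).div_const _).const_mul _

variable {𝒢}

/-- A graph has no loop-edges, so a step from a vertex to itself has weight zero. This matters
because `Loop.jumps x x` vanishes and would not count such a step. -/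
theorem ne_of_loopWeight_ne_zero {p : ℕ} {x : Fin (p + 1) → X} (h : 𝒢.loopWeight x ≠ 0) :
    x (Fin.last p) = x 0 ∧ ∀ i : Fin p, x i.castSucc ≠ x i.succ := by
  rw [loopWeight] at h
  split_ifs at h with hx
  · refine ⟨hx, fun i hi => Finset.prod_ne_zero_iff.1 h i (Finset.mem_univ i) ?_⟩
    rw [transition, hi, 𝒢.cond_eq_zero _ _ (𝒢.graph.loopless.irrefl _), zero_div,
      ENNReal.ofReal_zero]
  · exact absurd rfl h

theorem expNeg_loopFunctional (h𝒢 : 𝒢.Transient) (a : X → X → ℕ) (b : X → ℕ) {p : ℕ}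
    {x : Fin (p + 1) → X} {u : Fin (p + 1) → ℝ} (hx : x (Fin.last p) = x 0)
    (hne : ∀ i : Fin p, x i.castSucc ≠ x i.succ) (hu : ∀ i, 0 < u i) :
    expNeg (𝒢.loopFunctional a b (BasedLoop.toLoop (BasedLoop.mk x u))) =
      (∏ i : Fin p, ENNReal.ofReal (Real.exp (-(a (x i.castSucc) (x i.succ) : ℝ)))) *
        ∏ i, ENNReal.ofReal (Real.exp (-(b (x i) / 𝒢.dual (x i) * u i))) := by
  classical
  have hl := dual_pos h𝒢
  have h1 : ∑ v, ∑ w, (a v w : ℝ≥0∞) *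
      (Loop.jumps v w (BasedLoop.toLoop (BasedLoop.mk x u)) : ℝ≥0∞) =
      ∑ i : Fin p, (a (x i.castSucc) (x i.succ) : ℝ≥0∞) := by
    simp_rw [BasedLoop.jumps_toLoop u hx]
    push_cast
    simp_rw [Finset.mul_sum]
    rw [Finset.sum_congr rfl fun v _ => Finset.sum_comm, Finset.sum_comm]
    refine Finset.sum_congr rfl fun i _ => ?_
    rw [Finset.sum_eq_single (x i.castSucc), Finset.sum_eq_single (x i.succ)]
    · simp [hne i]
    · intro w _ hw; simp [hw.symm]
    · simp
    · intro v _ hv; simp [hv.symm]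
    · simp
  have h2 : ∑ v, (b v : ℝ≥0∞) * (Loop.time v (BasedLoop.toLoop (BasedLoop.mk x u)) /
      ENNReal.ofReal (𝒢.dual v)) =
      ∑ i, ENNReal.ofReal (b (x i) / 𝒢.dual (x i) * u i) := by
    simp_rw [BasedLoop.time_toLoop hx hu, div_eq_mul_inv, Finset.sum_mul, Finset.mul_sum]
    rw [Finset.sum_comm]
    refine Finset.sum_congr rfl fun i _ => ?_
    rw [Finset.sum_eq_single (x i)]
    · rw [if_pos rfl, ENNReal.ofReal_mul (mul_nonneg (Nat.cast_nonneg _) (inv_nonneg.2 (hl _).le)),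
        ENNReal.ofReal_mul (Nat.cast_nonneg _), ENNReal.ofReal_natCast,
        ENNReal.ofReal_inv_of_pos (hl _)]
      ring
    · intro v _ hv; simp [hv.symm]
    · simp
  rw [loopFunctional, h1, h2, expNeg_add, expNeg_sum, expNeg_sum]
  refine congrArg₂ _ ?_ ?_
  · refine Finset.prod_congr rfl fun i _ => ?_
    rw [← ENNReal.ofReal_natCast, expNeg_ofReal (Nat.cast_nonneg _)]
  · refine Finset.prod_congr rfl fun i _ => ?_
    rw [expNeg_ofReal (mul_nonneg (div_nonneg (Nat.cast_nonneg _) (hl _).le) (hu i).le)]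

variable [DecidableEq X]

/-- The Laplace exponent of the loop measure. -/
theorem lintegral_one_sub_expNeg_loopFunctional (h𝒢 : 𝒢.Transient) (a : X → X → ℕ) (b : X → ℕ) :
    Real.log (𝒢.loopMatrix (fun _ _ => 1) 0).det ≤
      Real.log (𝒢.loopMatrix (fun x y => Real.exp (-(a x y : ℝ))) (fun x => (b x : ℝ))).det ∧
    ∫⁻ l, (1 - expNeg (𝒢.loopFunctional a b l)) ∂𝒢.loopMeasure =
      ENNReal.ofReal (Real.log (𝒢.loopMatrix (fun x y => Real.exp (-(a x y : ℝ)))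
        (fun x => (b x : ℝ))).det - Real.log (𝒢.loopMatrix (fun _ _ => 1) 0).det) := by
  have hl := dual_pos h𝒢
  set s : X → X → ℝ := fun x y => Real.exp (-(a x y : ℝ)) with hs
  have hs0 : ∀ x y, 0 ≤ s x y := fun x y => (Real.exp_pos _).le
  have hs1 : ∀ x y, s x y ≤ 1 := fun x y => Real.exp_le_one_iff.2 (by simp)
  have hb : ∀ x, (0 : ℝ) ≤ (fun x => (b x : ℝ)) x := fun x => Nat.cast_nonneg _
  let q : ∀ {p : ℕ}, (Fin (p + 1) → X) → (Fin (p + 1) → ℝ) → ℝ≥0∞ := fun x u =>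
    expNeg (𝒢.loopFunctional a b (BasedLoop.toLoop (BasedLoop.mk x u)))
  have hq : ∀ {p : ℕ} (x : Fin (p + 1) → X), Measurable (q x) := fun x =>
    measurable_expNeg.comp ((𝒢.measurable_loopFunctional a b).comp
      (BasedLoop.measurable_toLoop.comp (BasedLoop.measurable_mk x)))
  let H : ℝ → ℝ≥0∞ := fun r => ∑' p : ℕ, ∑ x : Fin (p + 1) → X, 𝒢.loopWeight x *
    ∫⁻ u in {u : Fin (p + 1) → ℝ | ∀ i, 0 < u i},
      ENNReal.ofReal (Real.exp (-((1 + r) * ∑ i, u i))) * (1 - q x u)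
  have h1 : ∫⁻ l, (1 - expNeg (𝒢.loopFunctional a b l)) ∂𝒢.loopMeasure =
      ∫⁻ r in Set.Ioi (0 : ℝ), H r := by
    rw [lintegral_loopMeasure 𝒢 (g := fun l => 1 - expNeg (𝒢.loopFunctional a b l))
      (measurable_const.sub (measurable_expNeg.comp (𝒢.measurable_loopFunctional a b)))]
    have hm : ∀ {p : ℕ} (x : Fin (p + 1) → X), Measurable fun r : ℝ =>
        ∫⁻ u in {u : Fin (p + 1) → ℝ | ∀ i, 0 < u i},
          ENNReal.ofReal (Real.exp (-((1 + r) * ∑ i, u i))) * (1 - q x u) := fun x => by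
      refine Measurable.lintegral_prod_right ?_
      refine Measurable.mul (by fun_prop) (measurable_const.sub ((hq x).comp measurable_snd))
    rw [lintegral_tsum fun p => (Finset.measurable_sum _ fun x _ =>
      (hm x).const_mul _).aemeasurable]
    refine tsum_congr fun p => ?_
    rw [lintegral_finsetSum _ fun x _ => (hm x).const_mul _]
    refine Finset.sum_congr rfl fun x _ => ?_
    rw [lintegral_const_mul _ (hm x), lintegral_timeMeasure (h := fun u => 1 - q x u)
      (measurable_const.sub (hq x))]
  -- Written as a sum because subtraction on `[0, ∞]` is truncated. It says term by term that `(1 -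
  -- e^{-F}) + e^{-F} = 1`; finiteness of the traces recovers `H r` as a difference.
  have h2 : ∀ r : ℝ, 0 < r → H r +
      ENNReal.ofReal ((𝒢.loopMatrix s (fun x => (b x : ℝ)) + r • diagonal 𝒢.dual)⁻¹ *
        diagonal 𝒢.dual).trace =
      ENNReal.ofReal ((𝒢.loopMatrix (fun _ _ => 1) 0 + r • diagonal 𝒢.dual)⁻¹ *
        diagonal 𝒢.dual).trace := by
    intro r hr
    rw [← (tsum_loopWeight_resolvent h𝒢 hs0 hs1 hb hr.le).1, ← (tsum_loopWeight_resolvent h𝒢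
      (fun _ _ => zero_le_one) (fun _ _ => le_rfl) (b := 0) (fun _ => le_rfl) hr.le).1,
      ← ENNReal.tsum_add]
    refine tsum_congr fun p => ?_
    rw [← Finset.sum_add_distrib]
    refine Finset.sum_congr rfl fun x _ => ?_
    rw [← mul_add]
    rcases eq_or_ne (𝒢.loopWeight x) 0 with h0 | h0
    · rw [h0, zero_mul, zero_mul]
    obtain ⟨hx, hne⟩ := ne_of_loopWeight_ne_zero h0
    congr 1
    rw [← lintegral_const_mul _ (by fun_prop), ← lintegral_add_right _ (by fun_prop),
      ← lintegral_const_mul _ (by fun_prop)]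
    refine setLIntegral_congr_fun measurableSet_pos fun u hu => ?_
    have e1 : ∀ c : X → ℝ, ∏ i, ENNReal.ofReal (Real.exp (-((1 + r + c (x i)) * u i))) =
        ENNReal.ofReal (Real.exp (-((1 + r) * ∑ i, u i))) *
          ∏ i, ENNReal.ofReal (Real.exp (-(c (x i) * u i))) := by
      intro c
      rw [Finset.mul_sum, ← Finset.sum_neg_distrib, Real.exp_sum,
        ENNReal.ofReal_prod_of_nonneg fun i _ => (Real.exp_pos _).le, ← Finset.prod_mul_distrib]
      refine Finset.prod_congr rfl fun i _ => ?_
      rw [← ENNReal.ofReal_mul (Real.exp_pos _).le, ← Real.exp_add]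
      congr 2; ring
    have e2 := e1 fun y => (b y : ℝ) / 𝒢.dual y
    have e3 := e1 fun y => (0 : X → ℝ) y / 𝒢.dual y
    have e4 : q x u = _ := expNeg_loopFunctional h𝒢 a b hx hne hu
    beta_reduce at e2 e3 ⊢
    rw [e2, e3, mul_left_comm, ← e4, ← mul_add, tsub_add_cancel_of_le (expNeg_le_one _)]
    simp
  have hpos1 := loopMatrix_posDef h𝒢 (s := fun _ _ => 1) (fun _ _ => zero_le_one)
    (fun _ _ => le_rfl) (b := 0) (fun _ => le_rfl)
  have hpos2 := loopMatrix_posDef h𝒢 hs0 hs1 hb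
  have hnn : ∀ r : ℝ, 0 < r → 0 ≤ ((𝒢.loopMatrix (fun _ _ => 1) 0 + r • diagonal 𝒢.dual)⁻¹ *
        diagonal 𝒢.dual).trace := fun r hr => (tsum_loopWeight_resolvent h𝒢
      (fun _ _ => zero_le_one) (fun _ _ => le_rfl) (b := 0) (fun _ => le_rfl) hr.le).2
  have hnn2 := fun (r : ℝ) (hr : 0 < r) => (tsum_loopWeight_resolvent h𝒢 hs0 hs1 hb hr.le).2
  obtain ⟨h3, h4⟩ := lintegral_trace_resolvent_sub hpos1 hpos2 hl fun r hr =>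
    (ENNReal.ofReal_le_ofReal_iff (hnn r hr)).1 ((h2 r hr).symm ▸ le_add_self)
  refine ⟨h3, ?_⟩
  rw [h1, ← h4]
  refine setLIntegral_congr_fun measurableSet_Ioi fun r hr => ?_
  rw [ENNReal.ofReal_sub _ (hnn2 r hr), ← h2 r hr, ENNReal.add_sub_cancel_right ENNReal.ofReal_ne_top]

end ElectricalNetwork

/-! ### Conditional independence from a product density. -/

section ConditionalIndependence

/-- Conditional independence given a discrete random variable follows from a factorization of the
joint law on each of its level sets. -/
theorem condIndepGiven_of_factorization {Ω S₁ S₂ T : Type*} [MeasurableSpace Ω] [MeasurableSpace S₁]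
    [MeasurableSpace S₂] [MeasurableSpace T] [MeasurableSingletonClass T] {P : Measure Ω}
    [IsProbabilityMeasure P] {F₁ : Ω → S₁} {F₂ : Ω → S₂} {C : Ω → T} (hF₁ : Measurable F₁)
    (hF₂ : Measurable F₂) (hC : Measurable C) {s : Set T} (hs : s.Countable)
    (hmem : ∀ᵐ ω ∂P, C ω ∈ s)
    (h : ∀ c ∈ s, ∃ (f : Set S₁ → ℝ≥0∞) (g : Set S₂ → ℝ≥0∞), ∀ A B, MeasurableSet A →
      MeasurableSet B → P (F₁ ⁻¹' A ∩ F₂ ⁻¹' B ∩ C ⁻¹' {c}) = f A * g B) :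
    CondIndepGiven P F₁ F₂ C := by
  refine ⟨hF₁, hF₂, hC, fun A B hA hB => ?_⟩
  have hm : MeasurableSpace.comap C inferInstance ≤ (inferInstance : MeasurableSpace Ω) :=
    hC.comap_le
  have key : ∀ E : Set Ω, MeasurableSet E → ∀ ω₀ : Ω,
      (P⟦E | MeasurableSpace.comap C inferInstance⟧) ω₀ * (P (C ⁻¹' {C ω₀})).toReal =
        (P (E ∩ C ⁻¹' {C ω₀})).toReal := by
    intro E hE ω₀
    set φ := P⟦E | MeasurableSpace.comap C inferInstance⟧ with hφ
    have hφm : Measurable[MeasurableSpace.comap C inferInstance] φ :=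
      stronglyMeasurable_condExp.measurable
    -- A version measurable for the σ-algebra of `C` is constant on the level sets of `C`, so its
    -- value there is the elementary conditional probability.
    have hconst : ∀ ω ∈ C ⁻¹' {C ω₀}, φ ω = φ ω₀ := by
      intro ω hω
      obtain ⟨t, -, ht⟩ := hφm (measurableSet_singleton (φ ω₀))
      have h1 : ω₀ ∈ C ⁻¹' t := by rw [ht]; rfl
      have h2 : ω ∈ C ⁻¹' t := by
        rw [Set.mem_preimage, show C ω = C ω₀ from hω]; exact h1
      rw [ht] at h2
      exact h2
    have hset : MeasurableSet[MeasurableSpace.comap C inferInstance] (C ⁻¹' {C ω₀}) :=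
      ⟨_, measurableSet_singleton _, rfl⟩
    have h1 := setIntegral_condExp hm
      ((integrable_const (1 : ℝ)).indicator hE : Integrable (E.indicator fun _ => (1 : ℝ)) P) hset
    rw [setIntegral_congr_fun (hm _ hset) hconst, setIntegral_const,
      setIntegral_indicator hE, setIntegral_const] at h1
    simp only [smul_eq_mul, mul_one, Measure.real] at h1
    rw [mul_comm, h1, Set.inter_comm]
  have hpos : ∀ᵐ ω ∂P, P (C ⁻¹' {C ω}) ≠ 0 := by
    have h0 : P (⋃ c ∈ {c ∈ s | P (C ⁻¹' {c}) = 0}, C ⁻¹' {c}) = 0 := by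
      rw [measure_biUnion_null_iff (hs.mono fun c hc => hc.1)]
      exact fun c hc => hc.2
    filter_upwards [hmem, measure_eq_zero_iff_ae_notMem.1 h0] with ω h1 h2 h3
    exact h2 (Set.mem_biUnion (show C ω ∈ {c ∈ s | P (C ⁻¹' {c}) = 0} from ⟨h1, h3⟩) rfl)
  filter_upwards [hmem, hpos] with ω h1 h2
  obtain ⟨f, g, hfg⟩ := h _ h1
  have k1 := key _ ((hF₁ hA).inter (hF₂ hB)) ω
  have k2 := key _ (hF₁ hA) ω
  have k3 := key _ (hF₂ hB) ω
  have e2 := hfg A Set.univ hA MeasurableSet.univ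
  have e3 := hfg Set.univ B MeasurableSet.univ hB
  have e4 := hfg Set.univ Set.univ MeasurableSet.univ MeasurableSet.univ
  simp only [Set.preimage_univ, Set.univ_inter, Set.inter_univ] at e2 e3 e4
  rw [hfg A B hA hB, ENNReal.toReal_mul] at k1
  rw [e2, ENNReal.toReal_mul] at k2
  rw [e3, ENNReal.toReal_mul] at k3
  have hp : (P (C ⁻¹' {C ω})).toReal ≠ 0 :=
    ENNReal.toReal_ne_zero.2 ⟨h2, measure_ne_top _ _⟩
  have k4 : (P (C ⁻¹' {C ω})).toReal = (f Set.univ).toReal * (g Set.univ).toReal := by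
    rw [e4, ENNReal.toReal_mul]
  rw [Pi.mul_apply]
  -- With `p` the probability of the level set, `p = f(univ) g(univ)`; after multiplication by `p²`
  -- both sides are `f(A) g(B) f(univ) g(univ)`.
  refine mul_right_cancel₀ (mul_ne_zero hp hp) ?_
  rw [← mul_assoc, k1, mul_mul_mul_comm, k2, k3, k4]
  ring

theorem lintegral_pi_mul_compl {X 𝕂 : Type*} [Fintype X] [MeasureSpace 𝕂]
    [SigmaFinite (volume : Measure 𝕂)] (S : Set X) [Fintype S] [Fintype ↥Sᶜ]
    {f : (S → 𝕂) → ℝ≥0∞} {g : (↥Sᶜ → 𝕂) → ℝ≥0∞} (hf : Measurable f) (hg : Measurable g) :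
    ∫⁻ z : X → 𝕂, f (fun x => z x) * g (fun x => z x) = (∫⁻ z, f z) * ∫⁻ z, g z := by
  classical
  have h := volume_preserving_piEquivPiSubtypeProd (fun _ : X => 𝕂) (· ∈ S)
  rw [← lintegral_prod_mul hf.aemeasurable hg.aemeasurable]
  have h2 := h.lintegral_comp (f := fun q : (S → 𝕂) × (↥Sᶜ → 𝕂) => f q.1 * g q.2)
    ((hf.comp measurable_fst).mul (hg.comp measurable_snd))
  convert! h2 using 1
  rw [Measure.volume_eq_prod]
  congr!

/-- The coordinates are independent under the product measure, and the two functions use disjoint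
groups of them. -/
theorem lintegral_mul_of_disjoint_dependence {J : Type*} [Fintype J] (μ : J → Measure ℕ)
    [∀ e, IsProbabilityMeasure (μ e)] {f g : (J → ℕ) → ℝ≥0∞} {s t : Set J} (hst : Disjoint s t)
    (hf : ∀ n n', (∀ e ∈ s, n e = n' e) → f n = f n')
    (hg : ∀ n n', (∀ e ∈ t, n e = n' e) → g n = g n') :
    ∫⁻ n, f n * g n ∂Measure.pi μ = (∫⁻ n, f n ∂Measure.pi μ) * ∫⁻ n, g n ∂Measure.pi μ := by
  classical
  have hind := iIndepFun_pi (μ := μ) (X := fun _ k => k) (fun _ => aemeasurable_id)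
  have h2 := hind.indepFun_finset s.toFinset t.toFinset (Set.disjoint_toFinset.2 hst)
    fun e => measurable_pi_apply e
  let ext : ∀ S : Finset J, (S → ℕ) → J → ℕ := fun S v e => if h : e ∈ S then v ⟨e, h⟩ else 0
  have hf' : ∀ n, f n = f (ext s.toFinset fun e => n e) := fun n =>
    hf _ _ fun e he => by simp [ext, he]
  have hg' : ∀ n, g n = g (ext t.toFinset fun e => n e) := fun n =>
    hg _ _ fun e he => by simp [ext, he]
  have h3 := h2.comp (measurable_of_countable fun v => f (ext s.toFinset v))
    (measurable_of_countable fun v => g (ext t.toFinset v))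
  have h4 := lintegral_mul_eq_lintegral_mul_lintegral_of_indepFun
    (measurable_of_countable _) (measurable_of_countable _) h3
  simp only [Pi.mul_apply, Function.comp_apply, ← hf', ← hg'] at h4
  exact h4

theorem Set.prod_coe_mul_prod_coe_compl {X M : Type*} [Fintype X] [CommMonoid M] (S : Set X)
    [Fintype S] [Fintype ↥Sᶜ] (f : X → M) : (∏ x : S, f x) * ∏ x : ↥Sᶜ, f x = ∏ x, f x := by
  classical
  rw [← Fintype.prod_subtype_mul_prod_subtype (· ∈ S) f]
  congr!

theorem Set.indicator_preimage_inter_one {α β γ : Type*} {f : α → β} {g : α → γ} (A : Set β)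
    (B : Set γ) {C : Set α} {q : α} (hq : q ∈ C) :
    (f ⁻¹' A ∩ g ⁻¹' B ∩ C).indicator (1 : α → ℝ≥0∞) q =
      A.indicator (1 : β → ℝ≥0∞) (f q) * B.indicator (1 : γ → ℝ≥0∞) (g q) := by
  by_cases h1 : f q ∈ A <;> by_cases h2 : g q ∈ B <;> simp [h1, h2, hq]

/-- Conditional independence of restricted edge and vertex fields, whose joint law has a density
which is a product over the vertices, with respect to a measure under which everything is
independent. -/
theorem condIndepGiven_of_law {X 𝕂 Ω T : Type*} [Fintype X] [MeasureSpace 𝕂]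
    [SigmaFinite (volume : Measure 𝕂)] [MeasurableSpace Ω] [MeasurableSpace T]
    [MeasurableSingletonClass T] {P : Measure Ω} [IsProbabilityMeasure P] (X₁ : Set X)
    {N : Ω → X → X → ℝ≥0∞} {L : Ω → X → ℝ≥0∞} (hN : Measurable N) (hL : Measurable L)
    {Γ : (X → X → ℝ≥0∞) → T} (hΓ : Measurable Γ) {μ : X × X → Measure ℕ}
    [∀ e, IsProbabilityMeasure (μ e)] {obs : (X × X → ℕ) → X → X → ℝ≥0∞}
    (hobs : ∀ n n' x y, n (x, y) = n' (x, y) → n (y, x) = n' (y, x) → obs n x y = obs n' x y)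
    (hΓ1 : ∀ n n', Γ (obs n) = Γ (obs n') → ∀ x ∈ X₁, ∀ y ∉ X₁,
      obs n x y = obs n' x y ∧ obs n y x = obs n' y x)
    (hΓ2 : ∀ n n', (∀ x ∈ X₁, ∀ y ∉ X₁, n (x, y) = n' (x, y) ∧ n (y, x) = n' (y, x)) →
      Γ (obs n) = Γ (obs n'))
    {k : (X × X → ℕ) → X → 𝕂 → ℝ≥0∞} (hk : ∀ n x, Measurable (k n x))
    (hkobs : ∀ n n' x, (∀ y, obs n x y = obs n' x y ∧ obs n y x = obs n' y x) → k n x = k n' x)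
    {ℓ : 𝕂 → ℝ≥0∞} (hℓ : Measurable ℓ) {K : ℝ≥0∞}
    (hlaw : ∀ E : Set ((X → X → ℝ≥0∞) × (X → ℝ≥0∞)), MeasurableSet E →
      P {ω | (N ω, L ω) ∈ E} = K * ∫⁻ n, (∫⁻ z : X → 𝕂, (∏ x, k n x (z x)) *
        E.indicator 1 (obs n, fun x => ℓ (z x))) ∂Measure.pi μ) :
    CondIndepGiven P (restrictFields X₁ N L) (restrictFields X₁ᶜ N L) (fun ω => Γ (N ω)) := by
  classical
  have : ∀ S : Set X, Fintype S := fun S => Fintype.ofFinite S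
  have hres : ∀ S : Set X, Measurable fun q : (X → X → ℝ≥0∞) × (X → ℝ≥0∞) =>
      ((fun x y => q.1 x y, fun x => q.2 x) : (S → S → ℝ≥0∞) × (S → ℝ≥0∞)) := by
    intro S; fun_prop
  have hF : ∀ S, Measurable (restrictFields S N L) := fun S => (hres S).comp (hN.prodMk hL)
  have hs : (Set.range fun n : X × X → ℕ => Γ (obs n)).Countable := Set.countable_range _
  refine condIndepGiven_of_factorization (hF _) (hF _) (hΓ.comp hN) hs ?_ ?_
  · have h1 := hlaw {q | Γ q.1 ∉ Set.range fun n : X × X → ℕ => Γ (obs n)}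
      ((hΓ.comp measurable_fst) hs.measurableSet.compl)
    rw [ae_iff]
    refine h1.trans ?_
    have h2 : ∀ (n : X × X → ℕ) (z : X → 𝕂),
        {q : (X → X → ℝ≥0∞) × (X → ℝ≥0∞) | Γ q.1 ∉ Set.range fun n : X × X → ℕ =>
          Γ (obs n)}.indicator (1 : (X → X → ℝ≥0∞) × (X → ℝ≥0∞) → ℝ≥0∞) (obs n, fun x => ℓ (z x)) = 0 := fun n z =>
      Set.indicator_of_notMem (by simp) _
    simp_rw [h2]
    simp
  rintro _ ⟨n₀, rfl⟩
  -- Counts outside `s` are frozen at those of the reference configuration `n₀`. The integrals `φ`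
  -- thereby depend only on edges inside `S`, although the vertex weights there also involve the
  -- crossing edges.
  let glue : Set (X × X) → (X × X → ℕ) → X × X → ℕ := fun s n e => if e ∈ s then n e else n₀ e
  let φ : ∀ S : Set X, Set ((S → S → ℝ≥0∞) × (S → ℝ≥0∞)) → (X × X → ℕ) → ℝ≥0∞ := fun S A n =>
    ∫⁻ z : S → 𝕂, (∏ x : S, k (glue (S ×ˢ S) n) x (z x)) *
      A.indicator 1 (fun x y => obs (glue (S ×ˢ S) n) x y, fun x => ℓ (z x))
  let ψ : (X × X → ℕ) → ℝ≥0∞ := fun n => if Γ (obs n) = Γ (obs n₀) then 1 else 0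
  have hφdep : ∀ S A n n', (∀ e ∈ S ×ˢ S, n e = n' e) → φ S A n = φ S A n' := by
    intro S A n n' h
    have : glue (S ×ˢ S) n = glue (S ×ˢ S) n' := by
      ext e; simp only [glue]; split_ifs with he
      · exact h e he
      · rfl
    simp only [φ, this]
  have hψdep : ∀ n n', (∀ e ∈ (X₁ ×ˢ X₁ ∪ X₁ᶜ ×ˢ X₁ᶜ)ᶜ, n e = n' e) → ψ n = ψ n' := by
    intro n n' h
    have : Γ (obs n) = Γ (obs n') := hΓ2 _ _ fun x hx y hy => ⟨h _ (by simp [hx, hy]),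
      h _ (by simp [hx, hy])⟩
    simp only [ψ, this]
  -- On the level set of `n₀` the freezing is invisible: the observed counts at edges touching `S`
  -- agree with those of the glued configuration. Only the observations agree, not `n` itself, which
  -- is why `k` is required to factor through `obs`.
  have hobs_glue : ∀ S : Set X, (∀ n, Γ (obs n) = Γ (obs n₀) → ∀ x ∈ S, ∀ y ∉ S,
      obs n x y = obs n₀ x y ∧ obs n y x = obs n₀ y x) → ∀ n, Γ (obs n) = Γ (obs n₀) →
      ∀ x ∈ S, ∀ y, obs n x y = obs (glue (S ×ˢ S) n) x y ∧
        obs n y x = obs (glue (S ×ˢ S) n) y x := by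
    intro S hS n hn x hx y
    by_cases hy : y ∈ S
    · constructor <;> refine hobs _ _ _ _ ?_ ?_ <;> simp [glue, hx, hy]
    · have h1 : ∀ y' ∉ S, obs n₀ x y' = obs (glue (S ×ˢ S) n) x y' ∧
          obs n₀ y' x = obs (glue (S ×ˢ S) n) y' x := fun y' hy' => by
        constructor <;> refine hobs _ _ _ _ ?_ ?_ <;> simp [glue, hy']
      exact ⟨(hS n hn x hx y hy).1.trans (h1 y hy).1, (hS n hn x hx y hy).2.trans (h1 y hy).2⟩
  have hΓ1' : ∀ n, Γ (obs n) = Γ (obs n₀) → ∀ x ∈ X₁ᶜ, ∀ y ∉ X₁ᶜ,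
      obs n x y = obs n₀ x y ∧ obs n y x = obs n₀ y x := fun n hn x hx y hy =>
    (hΓ1 _ _ hn y (by simpa using hy) x hx).symm
  refine ⟨fun A => K * (∫⁻ n, φ X₁ A n ∂Measure.pi μ) * ∫⁻ n, ψ n ∂Measure.pi μ,
    fun B => ∫⁻ n, φ X₁ᶜ B n ∂Measure.pi μ, fun A B hA hB => ?_⟩
  have hE1 := (hres X₁) hA
  have hE2 := (hres X₁ᶜ) hB
  have hE3 : MeasurableSet {q : (X → X → ℝ≥0∞) × (X → ℝ≥0∞) | Γ q.1 = Γ (obs n₀)} :=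
    (hΓ.comp measurable_fst) (measurableSet_singleton _)
  have h1 := hlaw _ ((hE1.inter hE2).inter hE3)
  have hφm : ∀ (S : Set X) (A : Set ((S → S → ℝ≥0∞) × (S → ℝ≥0∞))), MeasurableSet A → ∀ n,
      Measurable fun z : S → 𝕂 => (∏ x : S, k (glue (S ×ˢ S) n) x (z x)) *
      A.indicator (1 : (S → S → ℝ≥0∞) × (S → ℝ≥0∞) → ℝ≥0∞)
        (fun x y => obs (glue (S ×ˢ S) n) x y, fun x => ℓ (z x)) := by
    intro S A hA n
    refine Measurable.mul (Finset.measurable_prod _ fun x _ =>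
      (hk _ _).comp (measurable_pi_apply x)) ?_
    refine (measurable_one.indicator hA).comp (measurable_const.prodMk ?_)
    exact measurable_pi_iff.2 fun x => hℓ.comp (measurable_pi_apply x)
  have h2 : ∀ n : X × X → ℕ, (∫⁻ z : X → 𝕂, (∏ x, k n x (z x)) *
      ((fun q : (X → X → ℝ≥0∞) × (X → ℝ≥0∞) => ((fun x y => q.1 x y, fun x => q.2 x) :
          (X₁ → X₁ → ℝ≥0∞) × (X₁ → ℝ≥0∞))) ⁻¹' A ∩
        (fun q : (X → X → ℝ≥0∞) × (X → ℝ≥0∞) => ((fun x y => q.1 x y, fun x => q.2 x) :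
          (↥X₁ᶜ → ↥X₁ᶜ → ℝ≥0∞) × (↥X₁ᶜ → ℝ≥0∞))) ⁻¹' B ∩
        {q | Γ q.1 = Γ (obs n₀)}).indicator 1 (obs n, fun x => ℓ (z x))) =
      φ X₁ A n * (φ X₁ᶜ B n * ψ n) := by
    intro n
    by_cases hn : Γ (obs n) = Γ (obs n₀)
    · have e1 := hobs_glue X₁ (fun n hn => hΓ1 _ _ hn) n hn
      have e2 := hobs_glue X₁ᶜ hΓ1' n hn
      simp only [ψ, if_pos hn, mul_one, φ]
      rw [← lintegral_pi_mul_compl X₁ (hφm _ A hA n) (hφm _ B hB n)]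
      refine lintegral_congr fun z => ?_
      rw [← Set.prod_coe_mul_prod_coe_compl X₁, mul_mul_mul_comm]
      congr 1
      · congr 1
        · exact Finset.prod_congr rfl fun x _ => by rw [hkobs _ _ _ (e1 x x.2)]
        · exact Finset.prod_congr rfl fun x _ => by rw [hkobs _ _ _ (e2 x x.2)]
      · have e3 : (fun x y : X₁ => obs (glue (X₁ ×ˢ X₁) n) x y) = fun x y : X₁ => obs n x y := by
          ext x y; exact (e1 x x.2 y).1.symm
        have e4 : (fun x y : ↥X₁ᶜ => obs (glue (X₁ᶜ ×ˢ X₁ᶜ) n) x y) =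
              fun x y : ↥X₁ᶜ => obs n x y := by
          ext x y; exact (e2 x x.2 y).1.symm
        rw [e3, e4]
        exact Set.indicator_preimage_inter_one A B hn
    · have e1 : ∀ z : X → 𝕂, (((fun q : (X → X → ℝ≥0∞) × (X → ℝ≥0∞) =>
          ((fun x y => q.1 x y, fun x => q.2 x) : (X₁ → X₁ → ℝ≥0∞) × (X₁ → ℝ≥0∞))) ⁻¹' A ∩
        (fun q : (X → X → ℝ≥0∞) × (X → ℝ≥0∞) => ((fun x y => q.1 x y, fun x => q.2 x) :
          (↥X₁ᶜ → ↥X₁ᶜ → ℝ≥0∞) × (↥X₁ᶜ → ℝ≥0∞))) ⁻¹' B ∩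
        {q | Γ q.1 = Γ (obs n₀)}).indicator (1 : (X → X → ℝ≥0∞) × (X → ℝ≥0∞) → ℝ≥0∞) (obs n, fun x => ℓ (z x))) = 0 :=
        fun z => Set.indicator_of_notMem (fun h => hn h.2) _
      simp only [e1, mul_zero, lintegral_zero, ψ, if_neg hn]
  refine (h1.trans ?_)
  -- The three factors depend on the edges within `X₁`, those within its complement, and the
  -- crossing edges; these sets are pairwise disjoint.
  rw [lintegral_congr h2, lintegral_mul_of_disjoint_dependence μ
    (s := X₁ ×ˢ X₁) (t := (X₁ ×ˢ X₁)ᶜ) disjoint_compl_right (hφdep X₁ A) ?_,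
    lintegral_mul_of_disjoint_dependence μ (s := X₁ᶜ ×ˢ X₁ᶜ) (t := (X₁ ×ˢ X₁ ∪ X₁ᶜ ×ˢ X₁ᶜ)ᶜ) ?_
      (hφdep X₁ᶜ B) hψdep]
  · ring
  · exact Set.disjoint_compl_right_iff_subset.2 Set.subset_union_right
  · intro n n' h
    rw [hφdep X₁ᶜ B n n' fun e he => h e fun he' => he.1 he'.1,
      hψdep n n' fun e he => h e fun he' => he (Or.inl he')]

end ConditionalIndependence

/-! ### Identification of a joint law by its Laplace transform. -/

section JointLaw

/-- A joint law of an edge field and a vertex field is identified by its Laplace transform. -/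
theorem measure_eq_of_lintegral_prod_expNeg_pow {X 𝕂 Ω : Type*} [Fintype X] [MeasureSpace 𝕂]
    [SigmaFinite (volume : Measure 𝕂)] [MeasurableSpace Ω] {P : Measure Ω} [IsProbabilityMeasure P]
    {N : Ω → X → X → ℝ≥0∞} {L : Ω → X → ℝ≥0∞} (hN : Measurable N) (hL : Measurable L)
    {μ : X × X → Measure ℕ} [∀ e, IsProbabilityMeasure (μ e)]
    {obs : (X × X → ℕ) → X → X → ℝ≥0∞} {k : (X × X → ℕ) → X → 𝕂 → ℝ≥0∞}
    (hk : ∀ n x, Measurable (k n x)) {ℓ : 𝕂 → ℝ≥0∞} (hℓ : Measurable ℓ) {K : ℝ≥0∞}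
    (h : ∀ (a : X → X → ℕ) (b : X → ℕ),
      ∫⁻ ω, (∏ e : X × X, expNeg (N ω e.1 e.2) ^ a e.1 e.2) * ∏ x, expNeg (L ω x) ^ b x ∂P =
        K * ∫⁻ n, (∫⁻ z : X → 𝕂, (∏ x, k n x (z x)) *
          ((∏ e : X × X, expNeg (obs n e.1 e.2) ^ a e.1 e.2) * ∏ x, expNeg (ℓ (z x)) ^ b x))
          ∂Measure.pi μ)
    {E : Set ((X → X → ℝ≥0∞) × (X → ℝ≥0∞))} (hE : MeasurableSet E) :
    P {ω | (N ω, L ω) ∈ E} = K * ∫⁻ n, (∫⁻ z : X → 𝕂, (∏ x, k n x (z x)) *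
        E.indicator 1 (obs n, fun x => ℓ (z x))) ∂Measure.pi μ := by
  let d : (X × X → ℕ) × (X → 𝕂) → ℝ≥0∞ := fun q => ∏ x, k q.1 x (q.2 x)
  have hd : Measurable d := measurable_from_prod_countable_right fun n =>
    Finset.measurable_prod _ fun x _ => (hk n x).comp (measurable_pi_apply x)
  let Q : Measure ((X × X → ℕ) × (X → 𝕂)) :=
    K • ((Measure.pi μ).prod volume).withDensity d
  have hQ : ∀ f : (X × X → ℕ) × (X → 𝕂) → ℝ≥0∞, Measurable f → ∫⁻ q, f q ∂Q =
      K * ∫⁻ n, (∫⁻ z : X → 𝕂, (∏ x, k n x (z x)) * f (n, z)) ∂Measure.pi μ := by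
    intro f hf
    rw [lintegral_smul_measure, lintegral_withDensity_eq_lintegral_mul _ hd hf,
      lintegral_prod _ (hd.mul hf).aemeasurable]
    rfl
  have hobs : Measurable obs := measurable_of_countable _
  let Φ : (X → X → ℝ≥0∞) × (X → ℝ≥0∞) → (X × X ⊕ X → ℝ≥0∞) := fun q =>
    Sum.elim (fun e => q.1 e.1 e.2) q.2
  let Ψ : (X × X ⊕ X → ℝ≥0∞) → (X → X → ℝ≥0∞) × (X → ℝ≥0∞) := fun v =>
    (fun x y => v (Sum.inl (x, y)), fun x => v (Sum.inr x))
  have hΦ : Measurable Φ := by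
    refine measurable_pi_iff.2 fun j => ?_
    cases j <;> simp only [Φ, Sum.elim_inl, Sum.elim_inr] <;> fun_prop
  have hΨ : Measurable Ψ := by fun_prop
  have hNL : Measurable fun ω => (N ω, L ω) := hN.prodMk hL
  have hol : Measurable fun q : (X × X → ℕ) × (X → 𝕂) => (obs q.1, fun x => ℓ (q.2 x)) :=
    (hobs.comp measurable_fst).prodMk (measurable_pi_iff.2 fun x =>
      hℓ.comp ((measurable_pi_apply x).comp measurable_snd))
  have hprod : ∀ m : X × X ⊕ X → ℕ, Measurable fun y : X × X ⊕ X → ℝ≥0∞ =>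
      ∏ j, expNeg (y j) ^ m j := fun m => Finset.measurable_prod _ fun j _ =>
    (measurable_expNeg.comp (measurable_pi_apply j)).pow_const _
  have hlap : ∀ m : X × X ⊕ X → ℕ,
      ∫⁻ y, ∏ j, expNeg (y j) ^ m j ∂(P.map fun ω => Φ (N ω, L ω)) =
        ∫⁻ y, ∏ j, expNeg (y j) ^ m j ∂(Q.map fun q => Φ (obs q.1, fun x => ℓ (q.2 x))) := by
    intro m
    rw [lintegral_map (g := fun ω => Φ (N ω, L ω)) (hprod m) (hΦ.comp hNL),
      lintegral_map (g := fun q : (X × X → ℕ) × (X → 𝕂) => Φ (obs q.1, fun x => ℓ (q.2 x))) (hprod m) (hΦ.comp hol),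
      hQ (fun q => ∏ j, expNeg (Φ (obs q.1, fun x => ℓ (q.2 x)) j) ^ m j)
        ((hprod m).comp (hΦ.comp hol))]
    simp only [Fintype.prod_sum_type, Φ, Sum.elim_inl, Sum.elim_inr]
    exact h (fun x y => m (Sum.inl (x, y))) fun x => m (Sum.inr x)
  have : IsFiniteMeasure (P.map fun ω => Φ (N ω, L ω)) :=
    Measure.isFiniteMeasure_map P _
  -- The Laplace transform at exponent `0` is the total mass, so it equals that of the image of `P`.
  have : IsFiniteMeasure (Q.map fun q => Φ (obs q.1, fun x => ℓ (q.2 x))) := by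
    have h0 := hlap 0
    simp only [Pi.zero_apply, pow_zero, Finset.prod_const_one, lintegral_const, one_mul] at h0
    exact ⟨h0 ▸ measure_lt_top _ _⟩
  have heq := Measure.ext_of_lintegral_prod_expNeg_pow hlap
  have h1 := congrArg (fun ν => ν (Ψ ⁻¹' E)) heq
  beta_reduce at h1
  rw [Measure.map_apply (f := fun ω => Φ (N ω, L ω)) (hΦ.comp hNL) (hΨ hE),
    Measure.map_apply (f := fun q : (X × X → ℕ) × (X → 𝕂) => Φ (obs q.1, fun x => ℓ (q.2 x)))
      (hΦ.comp hol) (hΨ hE)] at h1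
  refine Eq.trans ?_ (h1.trans ?_)
  · rfl
  · rw [← hQ (fun q => E.indicator 1 (obs q.1, fun x => ℓ (q.2 x)))
      ((measurable_one.indicator hE).comp hol)]
    exact (lintegral_indicator_one (hol hE)).symm

end JointLaw

/-! ### The fields of a Poisson ensemble of loops. -/

section LoopEnsemble

open Matrix

variable {X Ω : Type*} [Fintype X] [MeasurableSpace Ω] {η : Ω → Measure (Loop X)}

theorem measurable_jumpField (hη : Measurable η) : Measurable (jumpField η) := by
  refine measurable_pi_iff.2 fun x => measurable_pi_iff.2 fun y => ?_
  exact (Measure.measurable_lintegral ((measurable_of_countable fun n : ℕ => (n : ℝ≥0∞)).comp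
    (Loop.measurable_jumps x y))).comp hη

theorem measurable_symJumpField (hη : Measurable η) : Measurable (symJumpField η) := by
  have := measurable_jumpField hη
  refine measurable_pi_iff.2 fun x => measurable_pi_iff.2 fun y => ?_
  unfold symJumpField
  fun_prop

theorem measurable_occupationField (𝒢 : ElectricalNetwork X) (hη : Measurable η) :
    Measurable (occupationField 𝒢 η) := by
  refine measurable_pi_iff.2 fun x => ?_
  exact ((Measure.measurable_lintegral (Loop.measurable_time x)).comp hη).div_const _

omit [MeasurableSpace Ω] in
theorem ElectricalNetwork.lintegral_loopFunctional (𝒢 : ElectricalNetwork X) (a : X → X → ℕ)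
    (b : X → ℕ) (ω : Ω) : ∫⁻ l, 𝒢.loopFunctional a b l ∂η ω =
      ∑ e : X × X, (a e.1 e.2 : ℝ≥0∞) * jumpField η ω e.1 e.2 +
        ∑ x, (b x : ℝ≥0∞) * occupationField 𝒢 η ω x := by
  have hj : ∀ x y, Measurable fun l : Loop X => (Loop.jumps x y l : ℝ≥0∞) := fun x y =>
    (measurable_of_countable fun n : ℕ => (n : ℝ≥0∞)).comp (Loop.measurable_jumps x y)
  have ht : ∀ x, Measurable fun l : Loop X => Loop.time x l / ENNReal.ofReal (𝒢.dual x) :=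
    fun x => (Loop.measurable_time x).div_const _
  simp only [ElectricalNetwork.loopFunctional, ← Fintype.sum_prod_type']
  rw [lintegral_add_left (Finset.measurable_sum _ fun e _ => (hj _ _).const_mul _),
    lintegral_finsetSum _ fun e _ => (hj _ _).const_mul _,
    lintegral_finsetSum _ fun e _ => (ht _).const_mul _]
  simp only [lintegral_const_mul _ (hj _ _), lintegral_const_mul _ (ht _)]
  simp only [div_eq_mul_inv, lintegral_mul_const _ (Loop.measurable_time _)]
  rfl

variable [DecidableEq X] {P : Measure Ω} [IsProbabilityMeasure P] {𝒢 : ElectricalNetwork X}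

/-- The joint Laplace transform of the fields of a Poisson ensemble of loops. -/
theorem IsPoissonProcess.lintegral_expNeg_fields (h𝒢 : 𝒢.Transient) {α : ℝ≥0}
    (h : IsPoissonProcess P η (α • 𝒢.loopMeasure)) (a : X → X → ℕ) (b : X → ℕ) :
    ∫⁻ ω, (∏ e : X × X, expNeg (jumpField η ω e.1 e.2) ^ a e.1 e.2) *
        ∏ x, expNeg (occupationField 𝒢 η ω x) ^ b x ∂P =
      ENNReal.ofReal (Real.exp (-(α * (Real.log (𝒢.loopMatrix (fun x y => Real.exp (-(a x y : ℝ)))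
        (fun x => (b x : ℝ))).det - Real.log (𝒢.loopMatrix (fun _ _ => 1) 0).det)))) := by
  obtain ⟨h1, h2⟩ := ElectricalNetwork.lintegral_one_sub_expNeg_loopFunctional h𝒢 a b
  have h3 := h.lintegral_expNeg (𝒢.measurable_loopFunctional a b)
  rw [lintegral_smul_measure, h2] at h3
  simp only [𝒢.lintegral_loopFunctional, expNeg_add, expNeg_sum, expNeg_natCast_mul] at h3
  rw [h3, ENNReal.smul_def, smul_eq_mul, ← ENNReal.ofReal_coe_nnreal,
    ← ENNReal.ofReal_mul α.coe_nonneg, expNeg_ofReal (mul_nonneg α.coe_nonneg (sub_nonneg.2 h1))]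

/-- The joint law of the fields of a Poisson ensemble of loops, in terms of independent Poisson
numbers of jumps and of independent Gaussian spins. -/
theorem IsPoissonProcess.law_fields (h𝒢 : 𝒢.Transient) {α : ℝ≥0}
    (h : IsPoissonProcess P η (α • 𝒢.loopMeasure)) {𝕂 : Type*} [NormedAddCommGroup 𝕂]
    [InnerProductSpace ℝ 𝕂] [FiniteDimensional ℝ 𝕂] [MeasurableSpace 𝕂] [BorelSpace 𝕂]
    {ζ : 𝕂 → ℂ} (hζ : Continuous ζ) (hζn : ∀ z, ‖ζ z‖ = ‖z‖) {κ : ℕ → ℕ → ℝ → ℝ}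
    (hκm : ∀ a b, Measurable (κ a b)) (hκ0 : ∀ a b l, 0 ≤ l → 0 ≤ κ a b l)
    (hκi : ∀ a b c, 0 < c →
      Integrable fun z : 𝕂 => κ a b (‖z‖ ^ 2) * Real.exp (-(c * ‖z‖ ^ 2)))
    (hκ : ∀ a b c, 0 < c →
      ∫ z : 𝕂, ζ z ^ a * star (ζ z) ^ b * (Real.exp (-(c * ‖z‖ ^ 2)) : ℂ) =
        ((∫ z : 𝕂, κ a b (‖z‖ ^ 2) * Real.exp (-(c * ‖z‖ ^ 2)) : ℝ) : ℂ))
    {τ : (X → X → ℝ≥0∞) → X → X → ℝ≥0∞} (hτm : Measurable τ) {σ : (X → X → ℕ) → X → X → ℕ}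
    (hτ : ∀ (a : X → X → ℕ) (j : X → X → ℝ≥0∞), ∏ e : X × X, expNeg (τ j e.1 e.2) ^ a e.1 e.2 =
      ∏ e : X × X, expNeg (j e.1 e.2) ^ σ a e.1 e.2) {W : ℝ} (hW : 0 < W)
    (hV : ∀ (a : X → X → ℕ) (b : X → ℕ), ∫ z : X → 𝕂, Complex.exp (-∑ x, ∑ y,
        (𝒢.loopMatrix (fun x y => Real.exp (-(σ a x y : ℝ))) (fun x => (b x : ℝ)) x y : ℂ) *
          (ζ (z x) * star (ζ (z y)))) =
      ((W * Real.exp (-(α * (Real.log (𝒢.loopMatrix (fun x y => Real.exp (-(σ a x y : ℝ)))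
        (fun x => (b x : ℝ))).det - Real.log (𝒢.loopMatrix (fun _ _ => 1) 0).det))) : ℝ) : ℂ))
    (E : Set ((X → X → ℝ≥0∞) × (X → ℝ≥0∞))) (hE : MeasurableSet E) :
    P {ω | (τ (jumpField η ω), occupationField 𝒢 η ω) ∈ E} =
      ENNReal.ofReal (Real.exp (-∑ e : X × X, ((𝒢.cond e.1 e.2).toNNReal : ℝ)) * W)⁻¹ *
      ∫⁻ n : X × X → ℕ, (∫⁻ z : X → 𝕂, (∏ x, ENNReal.ofReal (κ (outDeg n x) (inDeg n x)
        (‖z x‖ ^ 2) * Real.exp (-(𝒢.dual x * ‖z x‖ ^ 2)))) *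
        E.indicator 1 (τ fun x y => (n (x, y) : ℝ≥0∞), fun x => ENNReal.ofReal (‖z x‖ ^ 2)))
        ∂Measure.pi (fun e => poissonMeasure (𝒢.cond e.1 e.2).toNNReal) := by
  -- `τ` is the passage from oriented counts to the observed ones, and `σ` its adjoint on Laplace
  -- exponents. `W` is the Gaussian integral without marks, so the prefactor is the normalizing
  -- constant.
  refine measure_eq_of_lintegral_prod_expNeg_pow (hτm.comp (measurable_jumpField h.measurable))
    (measurable_occupationField 𝒢 h.measurable)
    (k := fun n x z => ENNReal.ofReal (κ (outDeg n x) (inDeg n x) (‖z‖ ^ 2) *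
      Real.exp (-(𝒢.dual x * ‖z‖ ^ 2)))) (ℓ := fun z => ENNReal.ofReal (‖z‖ ^ 2))
    (obs := fun n => τ fun x y => (n (x, y) : ℝ≥0∞))
    (fun n x => ?_) (by fun_prop) (fun a b => ?_) hE
  · exact (((hκm _ _).comp (by fun_prop)).mul (by fun_prop)).ennreal_ofReal
  have hpos := ElectricalNetwork.loopMatrix_posDef h𝒢
    (s := fun x y => Real.exp (-(σ a x y : ℝ))) (fun x y => (Real.exp_pos _).le)
    (fun x y => Real.exp_le_one_iff.2 (by simp)) (b := fun x => (b x : ℝ))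
    (fun x => Nat.cast_nonneg _)
  have h1 := lintegral_spin_expansion hζ hζn hκ0 hκi hκ
    (C := fun x y => (𝒢.cond x y).toNNReal) (s := fun x y => Real.exp (-(σ a x y : ℝ)))
    (fun x y => (Real.exp_pos _).le) (D := fun x => 𝒢.dual x + b x)
    (by simp only [ElectricalNetwork.loopMatrix, Real.coe_toNNReal _ (𝒢.cond_nonneg _ _)])
    hpos (hV a b)
  have h2 : ∀ n : X × X → ℕ, (∫⁻ z : X → 𝕂, (∏ x, ENNReal.ofReal (κ (outDeg n x) (inDeg n x)
      (‖z x‖ ^ 2) * Real.exp (-(𝒢.dual x * ‖z x‖ ^ 2)))) *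
      ((∏ e : X × X, expNeg (τ (fun x y => (n (x, y) : ℝ≥0∞)) e.1 e.2) ^ a e.1 e.2) *
        ∏ x, expNeg (ENNReal.ofReal (‖z x‖ ^ 2)) ^ b x)) =
      (∏ e : X × X, ENNReal.ofReal (Real.exp (-(σ a e.1 e.2 : ℝ))) ^ n e) *
        ∫⁻ z : X → 𝕂, ∏ x, ENNReal.ofReal (κ (outDeg n x) (inDeg n x) (‖z x‖ ^ 2) *
          Real.exp (-((𝒢.dual x + b x) * ‖z x‖ ^ 2))) := by
    intro n
    have hm : Measurable fun z : X → 𝕂 => ∏ x, ENNReal.ofReal (κ (outDeg n x) (inDeg n x)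
        (‖z x‖ ^ 2) * Real.exp (-((𝒢.dual x + b x) * ‖z x‖ ^ 2))) :=
      Finset.measurable_prod _ fun x _ =>
        (((hκm _ _).comp (by fun_prop)).mul (by fun_prop)).ennreal_ofReal
    rw [← lintegral_const_mul _ hm]
    refine lintegral_congr fun z => ?_
    rw [hτ, mul_left_comm, ← Finset.prod_mul_distrib]
    congr 1
    · refine Finset.prod_congr rfl fun e _ => ?_
      rw [← ENNReal.ofReal_natCast, expNeg_ofReal (Nat.cast_nonneg _),
        ← ENNReal.ofReal_pow (Real.exp_pos _).le, ← ENNReal.ofReal_pow (Real.exp_pos _).le,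
        ← Real.exp_nat_mul, ← Real.exp_nat_mul]
      congr 2; ring
    · refine Finset.prod_congr rfl fun x _ => ?_
      rw [expNeg_ofReal (sq_nonneg _), ← ENNReal.ofReal_pow (Real.exp_pos _).le,
        ← ENNReal.ofReal_mul (mul_nonneg (hκ0 _ _ _ (sq_nonneg _)) (Real.exp_pos _).le),
        ← Real.exp_nat_mul, mul_assoc, ← Real.exp_add]
      congr 3; ring
  have h3 := h.lintegral_expNeg_fields h𝒢 (σ a) b
  have hc : 0 < Real.exp (-∑ e : X × X, ((𝒢.cond e.1 e.2).toNNReal : ℝ)) * W :=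
    mul_pos (Real.exp_pos _) hW
  simp only [Function.comp_apply, hτ] at h2 ⊢
  rw [h3, lintegral_congr h2, h1, ← ENNReal.ofReal_mul (inv_nonneg.2 hc.le), ← mul_assoc (Real.exp _),
    inv_mul_cancel_left₀ hc.ne']

/-- The unit intensity: the spins are complex. -/
theorem IsPoissonProcess.condIndepGiven_jumpField (h𝒢 : 𝒢.Transient)
    (h : IsPoissonProcess P η 𝒢.loopMeasure) (X₁ : Set X) :
    CondIndepGiven P (restrictFields X₁ (jumpField η) (occupationField 𝒢 η))
      (restrictFields X₁ᶜ (jumpField η) (occupationField 𝒢 η))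
      (fun (ω : Ω) (x : X₁) (y : ↥X₁ᶜ) => (jumpField η ω x y, jumpField η ω y x)) := by
  have hpos0 := ElectricalNetwork.loopMatrix_posDef h𝒢 (s := fun _ _ => 1)
    (fun _ _ => zero_le_one) (fun _ _ => le_rfl) (b := 0) (fun _ => le_rfl)
  have hdet0 := Matrix.det_ne_zero_of_forall_dotProduct_pos hpos0
  -- The average of `z^a z̄^b` over the phase: only configurations with as many jumps into each
  -- vertex as out of it survive.
  let κ : ℕ → ℕ → ℝ → ℝ := fun a b l => if a = b then l ^ a else 0
  have hκm : ∀ a b, Measurable (κ a b) := fun a b => by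
    simp only [κ]; split_ifs <;> fun_prop
  have hlaw := IsPoissonProcess.law_fields (P := P) (η := η) (α := 1) h𝒢 (by rwa [one_smul])
    (𝕂 := ℂ) (ζ := id) continuous_id (fun _ => rfl) (κ := κ) hκm
    (fun a b l hl => by simp only [κ]; split_ifs <;> positivity)
    (fun a b c hc => by
      simp only [κ]; split_ifs
      · exact integrable_sq_pow_mul_exp_neg a hc
      · simp)
    (fun a b c _ => integral_complex_moment a b c) (τ := id) measurable_id (σ := id)
    (fun _ _ => rfl) (W := Real.pi ^ Fintype.card X / |(𝒢.loopMatrix (fun _ _ => 1) 0).det|)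
    (div_pos (pow_pos Real.pi_pos _) (abs_pos.2 hdet0)) fun a b => by
      have hpos := ElectricalNetwork.loopMatrix_posDef h𝒢
        (s := fun x y => Real.exp (-(a x y : ℝ))) (fun x y => (Real.exp_pos _).le)
        (fun x y => Real.exp_le_one_iff.2 (by simp)) (b := fun x => (b x : ℝ))
        (fun x => Nat.cast_nonneg _)
      have hdet := Matrix.det_ne_zero_of_forall_dotProduct_pos hpos
      refine (integral_cexp_neg_sesquilinear hpos).trans (congrArg _ ?_)
      simp only [id, NNReal.coe_one, one_mul]
      rw [neg_sub, Real.exp_sub, Real.exp_log_eq_abs hdet0, Real.exp_log_eq_abs hdet,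
        div_mul_div_cancel₀ (abs_ne_zero.2 hdet0)]
  have hcast : ∀ {n n' : X × X → ℕ} {e : X × X}, (n e : ℝ≥0∞) = n' e → n e = n' e :=
    fun h => Nat.cast_injective h
  refine condIndepGiven_of_law (𝕂 := ℂ) X₁ (measurable_jumpField h.measurable)
    (measurable_occupationField 𝒢 h.measurable)
    (Γ := fun N (x : X₁) (y : ↥X₁ᶜ) => (N x y, N y x)) (by fun_prop)
    (obs := fun n x y => (n (x, y) : ℝ≥0∞)) (fun n n' x y h1 _ => by simp only [h1])
    (fun n n' hn x hx y hy => ?_) (fun n n' hn => ?_)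
    (k := fun n x z => ENNReal.ofReal (κ (outDeg n x) (inDeg n x) (‖z‖ ^ 2) *
      Real.exp (-(𝒢.dual x * ‖z‖ ^ 2)))) (fun n x => ?_) (fun n n' x hn => ?_)
    (ℓ := fun z => ENNReal.ofReal (‖z‖ ^ 2)) (by fun_prop) hlaw
  · exact Prod.ext_iff.1 (congrFun (congrFun hn ⟨x, hx⟩) ⟨y, hy⟩)
  · funext x y
    simp only [hn x x.2 y y.2]
  · exact (((hκm _ _).comp (by fun_prop)).mul (by fun_prop)).ennreal_ofReal
  · have h1 : outDeg n x = outDeg n' x := Finset.sum_congr rfl fun y _ => hcast (hn y).1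
    have h2 : inDeg n x = inDeg n' x := Finset.sum_congr rfl fun y _ => hcast (hn y).2
    rw [h1, h2]

/-- Intensity one half: the spins are real. -/
theorem IsPoissonProcess.condIndepGiven_symJumpField (h𝒢 : 𝒢.Transient)
    (h : IsPoissonProcess P η ((2⁻¹ : ℝ≥0) • 𝒢.loopMeasure)) (X₁ : Set X) :
    CondIndepGiven P (restrictFields X₁ (symJumpField η) (occupationField 𝒢 η))
      (restrictFields X₁ᶜ (symJumpField η) (occupationField 𝒢 η))
      (fun (ω : Ω) (x : X₁) (y : ↥X₁ᶜ) => symJumpField η ω x y) := by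
  -- Marking unoriented counts by `a` marks oriented ones by `a x y + a y x`; this keeps the matrix
  -- symmetric, as the real Gaussian integral requires.
  let σ : (X → X → ℕ) → X → X → ℕ := fun a x y => a x y + a y x
  let τ : (X → X → ℝ≥0∞) → X → X → ℝ≥0∞ := fun j x y => j x y + j y x
  have hsymm : ∀ (s : X → X → ℝ) (b : X → ℝ), (∀ x y, s x y = s y x) →
      (𝒢.loopMatrix s b).IsSymm := by
    intro s b hs
    rw [ElectricalNetwork.loopMatrix]
    refine (isSymm_diagonal _).sub (Matrix.ext fun x y => ?_)
    simp only [transpose_apply, of_apply, hs y x, 𝒢.cond_symm y x]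
  have hpos0 := Matrix.posDef_of_forall_dotProduct_pos (hsymm (fun _ _ => 1) 0 fun _ _ => rfl)
    (ElectricalNetwork.loopMatrix_posDef h𝒢 (fun _ _ => zero_le_one) (fun _ _ => le_rfl)
      (b := 0) (fun _ => le_rfl))
  have hdet0 := hpos0.det_pos
  -- The average of `z^(a+b)` over the sign of a real spin: only the parity of the total degree is
  -- constrained.
  let κ : ℕ → ℕ → ℝ → ℝ := fun a b l => if Even (a + b) then l ^ ((a + b) / 2) else 0
  have hκm : ∀ a b, Measurable (κ a b) := fun a b => by
    simp only [κ]; split_ifs <;> fun_prop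
  have hlaw := IsPoissonProcess.law_fields h𝒢 h
    (𝕂 := ℝ) (ζ := fun z => (z : ℂ)) Complex.continuous_ofReal Complex.norm_real (κ := κ) hκm
    (fun a b l hl => by simp only [κ]; split_ifs <;> positivity)
    (fun a b c hc => by
      simp only [κ]; split_ifs
      · exact integrable_sq_pow_mul_exp_neg _ hc
      · simp)
    (fun a b c _ => integral_real_moment a b c) (τ := τ) (by fun_prop) (σ := σ)
    (fun a j => by
      simp only [τ, σ, expNeg_add, mul_pow, pow_add, Finset.prod_mul_distrib]
      congr 1
      exact (Equiv.prodComm X X).prod_comp fun e => expNeg (j e.1 e.2) ^ a e.2 e.1)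
    (W := √Real.pi ^ Fintype.card X / √(𝒢.loopMatrix (fun _ _ => 1) 0).det)
    (div_pos (pow_pos (Real.sqrt_pos.2 Real.pi_pos) _) (Real.sqrt_pos.2 hdet0)) fun a b => by
      have hpos := Matrix.posDef_of_forall_dotProduct_pos
        (hsymm (fun x y => Real.exp (-(σ a x y : ℝ))) (fun x => (b x : ℝ))
          fun x y => by simp only [σ, add_comm])
        (ElectricalNetwork.loopMatrix_posDef h𝒢 (fun x y => (Real.exp_pos _).le)
          (fun x y => Real.exp_le_one_iff.2 (by simp)) (fun x => Nat.cast_nonneg _))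
      have h1 : ∀ z : X → ℝ, Complex.exp (-∑ x, ∑ y,
          (𝒢.loopMatrix (fun x y => Real.exp (-(σ a x y : ℝ))) (fun x => (b x : ℝ)) x y : ℂ) *
            ((z x : ℂ) * star (z y : ℂ))) = ((Real.exp (-(z ⬝ᵥ 𝒢.loopMatrix
              (fun x y => Real.exp (-(σ a x y : ℝ))) (fun x => (b x : ℝ)) *ᵥ z)) : ℝ) : ℂ) := by
        intro z
        simp only [dotProduct, mulVec, Finset.mul_sum]
        push_cast
        congr 2
        refine Finset.sum_congr rfl fun x _ => Finset.sum_congr rfl fun y _ => ?_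
        rw [show star (z y : ℂ) = z y from Complex.conj_ofReal _]
        ring
      simp_rw [h1]
      rw [integral_complex_ofReal, integral_exp_neg_dotProduct hpos]
      congr 1
      -- The exponent `1/2` on the determinants matches the square root in the real Gaussian
      -- integral.
      have h2 : ∀ c d : ℝ, 0 < c → 0 < d → Real.exp (-(((2⁻¹ : ℝ≥0) : ℝ) *
          (Real.log c - Real.log d))) = √d / √c := by
        intro c d hc hd
        rw [← Real.exp_log (Real.sqrt_pos.2 hd), ← Real.exp_log (Real.sqrt_pos.2 hc),
          ← Real.exp_sub, Real.log_sqrt hd.le, Real.log_sqrt hc.le]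
        congr 1; push_cast; ring
      rw [h2 _ _ hpos.det_pos hdet0, div_mul_div_cancel₀ (Real.sqrt_pos.2 hdet0).ne']
  refine condIndepGiven_of_law (𝕂 := ℝ) X₁ (measurable_symJumpField h.measurable)
    (measurable_occupationField 𝒢 h.measurable)
    (Γ := fun N (x : X₁) (y : ↥X₁ᶜ) => N x y) (by fun_prop)
    (obs := fun n => τ fun x y => (n (x, y) : ℝ≥0∞)) (fun n n' x y h1 h2 => by simp only [τ, h1, h2])
    (fun n n' hn x hx y hy => ?_) (fun n n' hn => ?_)
    (k := fun n x z => ENNReal.ofReal (κ (outDeg n x) (inDeg n x) (‖z‖ ^ 2) *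
      Real.exp (-(𝒢.dual x * ‖z‖ ^ 2)))) (fun n x => ?_) (fun n n' x hn => ?_)
    (ℓ := fun z => ENNReal.ofReal (‖z‖ ^ 2)) (by fun_prop) hlaw
  · have h1 := congrFun (congrFun hn ⟨x, hx⟩) ⟨y, hy⟩
    exact ⟨h1, by simpa only [τ, add_comm] using h1⟩
  · funext x y
    simp only [τ, hn x x.2 y y.2]
  · exact (((hκm _ _).comp (by fun_prop)).mul (by fun_prop)).ennreal_ofReal
  -- The real weight involves only the sum of the two degrees, which the unoriented counts
  -- determine; conditioning on these therefore suffices.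
  · have h1 : outDeg n x + inDeg n x = outDeg n' x + inDeg n' x := by
      simp only [outDeg, inDeg, ← Finset.sum_add_distrib]
      refine Finset.sum_congr rfl fun y _ => ?_
      have := (hn y).1
      simp only [τ] at this
      exact_mod_cast this
    simp only [κ, h1]

end LoopEnsemble

/-! ### The theorem, with `X₂` identified with the complement of `X₁`. -/

theorem mainTheorem1 {X : Type*} [Fintype X] (𝒢 : ElectricalNetwork X) (h𝒢 : 𝒢.Transient)
    (X₁ X₂ : Set X) (hX : IsCompl X₁ X₂)
    {Ω : Type*} [MeasurableSpace Ω] (P : Measure Ω) [IsProbabilityMeasure P]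
    (η : Ω → Measure (Loop X)) :
    (IsPoissonProcess P η 𝒢.loopMeasure →
      CondIndepGiven P
        (restrictFields X₁ (jumpField η) (occupationField 𝒢 η))
        (restrictFields X₂ (jumpField η) (occupationField 𝒢 η))
        (fun (ω : Ω) (x : X₁) (y : X₂) => (jumpField η ω x y, jumpField η ω y x))) ∧
    (IsPoissonProcess P η ((2⁻¹ : ℝ≥0∞) • 𝒢.loopMeasure) →
      CondIndepGiven P
        (restrictFields X₁ (symJumpField η) (occupationField 𝒢 η))
        (restrictFields X₂ (symJumpField η) (occupationField 𝒢 η))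
        (fun (ω : Ω) (x : X₁) (y : X₂) => symJumpField η ω x y)) := by
  classical
  obtain rfl := hX.compl_eq
  refine ⟨fun h => h.condIndepGiven_jumpField h𝒢 X₁, fun h => ?_⟩
  refine IsPoissonProcess.condIndepGiven_symJumpField h𝒢 ?_ X₁
  have h2 : ((2⁻¹ : ℝ≥0) : ℝ≥0∞) = 2⁻¹ := by simp
  rwa [← h2] at h
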